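/- Let $H\in\mathbb C[x,y]$, let $t_0$ be a regular value of $H$ (i.e. $dH\neq 0$ at every point of $X=\{H=t_0\}$), let $p_0\in X$, let $\eta$ be a polynomial one-form on $\mathbb C^2$, and let $\Gamma:(\mathbb C,t_0)\to(\mathbb C^2,p_0)$ be the germ of a holomorphic transversal parametrized by the values of $H$, $H(\Gamma(t))=t$. Let $\pi_1=\pi_1(X,p_0)$, where $\alpha\beta$ means $\alpha$ followed by $\beta$. For $\delta\in\pi_1$ let $$P^\delta_\varepsilon(t)=t+\varepsilon M_1^\delta(t)+\varepsilon^2M_2^\delta(t)+\cdots$$ be the holonomy map (from $\Gamma$ to $\Gamma$, along $\delta$) of the foliations $dH+\varepsilon\eta=0$. It is a well-defined germ at $(\varepsilon,t)=(0,t_0)$ of a holomorphic function: it exists and is unique for every loop in $X$ based at $p_0$, and depends only on the homotopy class of the loop. The Melnikov functions $M_j^\delta$ are germs of holomorphic functions on $(\mathbb C,t_0)$. Let $\pi_1=L_1\supset L_2\supset\cdots$, $L_{k+1}=[L_k,\pi_1]$, be the lower central series, let $\operatorname{gr}\pi_1=\bigoplus_{k\ge1}L_k/L_{k+1}$ be the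 associated graded Lie algebra (over $\mathbb Z$), with the bracket induced by the commutator $[\delta,\delta']=\delta\delta'\delta^{-1}\delta'^{-1}$, and let $\mathfrak X(\mathbb C,t_0)$ be the Lie algebra of germs of holomorphic vector fields on $(\mathbb C,t_0)$ (which is identified with $(\mathbb C,0)$ by the coordinate $t-t_0$), with the commutator of derivations as bracket. Define $$v_{k,\eta}:L_k\to\mathfrak X(\mathbb C,t_0),\qquad v_{k,\eta}(\delta)=M_k^\delta\,\partial_t .$$ Then the maps $v_{k,\eta}$, $k\ge1$, induce a Lie algebra homomorphism $v_\eta:\operatorname{gr}\pi_1\to\mathfrak X(\mathbb C,t_0)$: there is a unique Lie algebra homomorphism $v_\eta$ over $\mathbb Z$ that maps the class in $L_k/L_{k+1}$ of each $\delta\in L_k$ to $v_{k,\eta}(\delta)$, for every $k\ge1$. Moreover, for all $k,k'\ge1$, $\delta\in L_k$ and $\delta'\in L_{k'}$, $$v_{k+k',\eta}([\delta,\delta'])=[v_{k,\eta}(\delta),v_{k',\eta}(\delta')]=W(M_k^\delta,M_{k'}^{\delta'})\,\partial_t ,$$ where $W(f,g)=fg'-f'g$ is the Wronskian. -/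

import Mathlib

open Filter Topology MvPolynomial

noncomputable section

/-! ### The graded Lie ring of a group -/

section GradedLie

open scoped commutatorElement

variable (G : Type*) [Group G]

/-- The lower central series indexed from one: `L₁ = G`, `L_{k+1} = [L_k, G]`. -/
def lcs (k : ℕ+) : Subgroup G := (⊤ : Subgroup G).lowerCentralSeries (k.natPred)

instance lcs_normal (k : ℕ+) : (lcs G k).Normal := by unfold lcs; infer_instance

variable {G}

theorem lcs_succ_le (k : ℕ+) : lcs G (k + 1) ≤ lcs G k := by
  unfold lcs
  apply Subgroup.lowerCentralSeries_antitone
  simp [PNat.natPred]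

theorem lcs_anti {k l : ℕ+} (h : k ≤ l) : lcs G l ≤ lcs G k := by
  unfold lcs
  apply Subgroup.lowerCentralSeries_antitone
  exact PNat.natPred_le_natPred.mpr h

theorem three_subgroups {A B C N : Subgroup G} [hN : N.Normal]
    (h1 : ⁅⁅B, C⁆, A⁆ ≤ N) (h2 : ⁅⁅C, A⁆, B⁆ ≤ N) : ⁅⁅A, B⁆, C⁆ ≤ N := by
  have key : ∀ K : Subgroup G, K ≤ N ↔ K.map (QuotientGroup.mk' N) = ⊥ := by
    intro K
    rw [Subgroup.map_eq_bot_iff, QuotientGroup.ker_mk']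
  rw [key] at *
  simp only [Subgroup.map_commutator] at *
  exact Subgroup.commutator_commutator_eq_bot_of_rotate h1 h2

theorem lowerCentralSeries_commutator_le (n m : ℕ) :
    ⁅(⊤ : Subgroup G).lowerCentralSeries m, (⊤ : Subgroup G).lowerCentralSeries n⁆ ≤
      (⊤ : Subgroup G).lowerCentralSeries (m + n + 1) := by
  induction n generalizing m with
  | zero =>
    rw [Subgroup.lowerCentralSeries_zero, add_zero]
    exact le_of_eq (Subgroup.lowerCentralSeries_succ _ _).symm
  | succ n ih =>
    rw [Subgroup.commutator_comm, Subgroup.lowerCentralSeries_succ]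
    apply three_subgroups
    · rw [Subgroup.commutator_comm ⊤, ← Subgroup.lowerCentralSeries_succ]
      refine (ih (m + 1)).trans (le_of_eq ?_)
      congr 1; ring
    · refine (Subgroup.commutator_mono (ih m) le_rfl).trans (le_of_eq ?_)
      rw [← Subgroup.lowerCentralSeries_succ]
      congr 1

theorem lcs_commutator_le (k l : ℕ+) : ⁅lcs G k, lcs G l⁆ ≤ lcs G (k + l) := by
  unfold lcs
  refine (lowerCentralSeries_commutator_le _ _).trans (le_of_eq ?_)
  congr 1
  have h1 := PNat.natPred_add_one k
  have h2 := PNat.natPred_add_one l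
  have h3 := PNat.natPred_add_one (k + l)
  rw [PNat.add_coe] at h3
  omega

/-- The group commutator `[x, y] = x y x⁻¹ y⁻¹` as a map `L_k × L_l → L_{k+l}`. -/
def lcsComm {k l : ℕ+} (x : lcs G k) (y : lcs G l) : lcs G (k + l) :=
  ⟨⁅(x : G), (y : G)⁆, lcs_commutator_le k l (Subgroup.commutator_mem_commutator x.2 y.2)⟩

variable (G) in
/-- The quotient `L_k / L_{k+1}`, written multiplicatively. -/
abbrev LcsQuot (k : ℕ+) : Type _ := lcs G k ⧸ (lcs G (k + 1)).subgroupOf (lcs G k)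

theorem lcsQuot_mk_eq {k : ℕ+} {x y : lcs G k} :
    (QuotientGroup.mk x : LcsQuot G k) = QuotientGroup.mk y ↔
      (x : G)⁻¹ * (y : G) ∈ lcs G (k + 1) := by
  rw [QuotientGroup.eq, Subgroup.mem_subgroupOf]
  rfl

instance lcsQuotCommGroup (k : ℕ+) : CommGroup (LcsQuot G k) where
  mul_comm := by
    intro a b
    induction a using QuotientGroup.induction_on with | _ x => ?_
    induction b using QuotientGroup.induction_on with | _ y => ?_
    rw [← QuotientGroup.mk_mul, ← QuotientGroup.mk_mul, lcsQuot_mk_eq]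
    have h : ⁅(y : G)⁻¹, (x : G)⁻¹⁆ ∈ lcs G (k + 1) := by
      refine lcs_anti ?_ (lcs_commutator_le k k (Subgroup.commutator_mem_commutator
        (inv_mem y.2) (inv_mem x.2)))
      exact add_le_add_right one_le k
    convert h using 1
    simp [commutatorElement_def, mul_assoc]

/-- Conjugating an element of `L_k` does not change its class modulo `L_{k+1}`. -/
theorem lcs_conj_mem {k : ℕ+} {c : G} (hc : c ∈ lcs G k) (g : G) :
    c⁻¹ * (g * c * g⁻¹) ∈ lcs G (k + 1) := by
  have h : ⁅c⁻¹, g⁆ ∈ lcs G (k + 1) :=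
    lcs_anti le_rfl (lcs_commutator_le k 1 (Subgroup.commutator_mem_commutator
      (inv_mem hc) (by simp [lcs, PNat.natPred])))
  convert h using 1
  simp [commutatorElement_def, mul_assoc]

/-- The class of the commutator is multiplicative in the second variable. -/
def lcsCommRight (k l : ℕ+) (x : lcs G k) : lcs G l →* LcsQuot G (k + l) :=
  MonoidHom.mk' (fun y => QuotientGroup.mk (lcsComm x y)) (by
    intro y z
    have h : (QuotientGroup.mk (lcsComm x z) : LcsQuot G (k + l)) =
        QuotientGroup.mk ⟨y * (lcsComm x z : G) * (y : G)⁻¹,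
          (lcs_normal G (k + l)).conj_mem _ (lcsComm x z).2 _⟩ :=
      lcsQuot_mk_eq.mpr (lcs_conj_mem (lcsComm x z).2 _)
    rw [h, ← QuotientGroup.mk_mul]
    congr 1
    apply Subtype.ext
    simp [lcsComm, commutatorElement_def, mul_assoc])

/-- The commutator map `L_k / L_{k+1} × L_l / L_{l+1} → L_{k+l} / L_{k+l+1}`. -/
def lcsQuotComm (k l : ℕ+) : LcsQuot G k →* LcsQuot G l →* LcsQuot G (k + l) :=
  QuotientGroup.lift _
    (MonoidHom.mk' (fun x => QuotientGroup.lift _ (lcsCommRight k l x) (by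
        intro y hy
        rw [Subgroup.mem_subgroupOf] at hy
        change (QuotientGroup.mk (lcsComm x y) : LcsQuot G (k + l)) = 1
        rw [QuotientGroup.eq_one_iff, Subgroup.mem_subgroupOf]
        exact lcs_anti (le_of_eq (add_assoc k l 1)) (lcs_commutator_le k (l + 1)
          (Subgroup.commutator_mem_commutator x.2 hy))))
      (by
        intro x y
        ext z
        change (QuotientGroup.mk (lcsComm (x * y) z) : LcsQuot G (k + l)) =
          QuotientGroup.mk (lcsComm x z) * QuotientGroup.mk (lcsComm y z)
        have h : (QuotientGroup.mk (lcsComm y z) : LcsQuot G (k + l)) =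
            QuotientGroup.mk ⟨x * (lcsComm y z : G) * (x : G)⁻¹,
              (lcs_normal G (k + l)).conj_mem _ (lcsComm y z).2 _⟩ :=
          lcsQuot_mk_eq.mpr (lcs_conj_mem (lcsComm y z).2 _)
        rw [mul_comm, h, ← QuotientGroup.mk_mul]
        congr 1
        apply Subtype.ext
        simp [lcsComm, commutatorElement_def, mul_assoc]))
    (by
      intro x hx
      rw [Subgroup.mem_subgroupOf] at hx
      ext z
      change (QuotientGroup.mk (lcsComm x z) : LcsQuot G (k + l)) = 1
      rw [QuotientGroup.eq_one_iff, Subgroup.mem_subgroupOf]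
      refine lcs_anti (le_of_eq ?_) (lcs_commutator_le (k + 1) l
          (Subgroup.commutator_mem_commutator hx z.2))
      rw [add_right_comm])

variable (G) in
/-- The graded group `gr G = ⨁_{k ≥ 1} L_k / L_{k+1}`, written additively. -/
def Gr : Type _ := DirectSum ℕ+ (fun k => Additive (LcsQuot G k))

instance : AddCommGroup (Gr G) :=
  inferInstanceAs (AddCommGroup (DirectSum ℕ+ (fun k => Additive (LcsQuot G k))))

namespace Gr

/-- The inclusion of the homogeneous component of degree `k`. -/
def of (k : ℕ+) : Additive (LcsQuot G k) →+ Gr G :=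
  DirectSum.of (fun k => Additive (LcsQuot G k)) k

/-- The class in degree `k` of an element of `L_k`. -/
def cls (k : ℕ+) (x : lcs G k) : Gr G := of k (Additive.ofMul (QuotientGroup.mk x))

/-- The biadditive extension to `gr G` of the commutator maps. -/
def bracketHom : Gr G →+ Gr G →+ Gr G :=
  DirectSum.toAddMonoid fun k => AddMonoidHom.flip <| DirectSum.toAddMonoid fun l =>
    AddMonoidHom.flip <| AddMonoidHom.mk'
      (fun a => AddMonoidHom.mk'
        (fun b => of (k + l) (Additive.ofMul (lcsQuotComm k l a.toMul b.toMul)))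
        (by intro b c; rw [toMul_add, map_mul, ofMul_mul, map_add]))
      (by
        intro a b
        refine AddMonoidHom.ext fun c => ?_
        simp only [AddMonoidHom.mk'_apply, AddMonoidHom.add_apply]
        rw [toMul_add, map_mul, MonoidHom.mul_apply, ofMul_mul, map_add])

instance : Bracket (Gr G) (Gr G) := ⟨fun a b => bracketHom a b⟩

theorem bracket_def (a b : Gr G) : ⁅a, b⁆ = bracketHom a b := rfl

theorem cls_bracket {k l : ℕ+} (x : lcs G k) (y : lcs G l) :
    ⁅cls k x, cls l y⁆ = cls (k + l) (lcsComm x y) := by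
  rw [bracket_def]
  unfold cls of bracketHom
  erw [DirectSum.toAddMonoid_of, AddMonoidHom.flip_apply, DirectSum.toAddMonoid_of]
  rfl

theorem cls_mul {k : ℕ+} (x y : lcs G k) : cls k (x * y) = cls k x + cls k y := by
  unfold cls
  rw [QuotientGroup.mk_mul, ofMul_mul, map_add]

theorem cls_one (k : ℕ+) : cls k (1 : lcs G k) = 0 := by
  have h := cls_mul (1 : lcs G k) 1
  rw [mul_one] at h
  exact left_eq_add.mp h

theorem cls_inv {k : ℕ+} (x : lcs G k) : cls k x⁻¹ = -cls k x := by
  rw [eq_neg_iff_add_eq_zero, ← cls_mul, inv_mul_cancel, cls_one]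

theorem cls_congr {k l : ℕ+} (h : k = l) {x : lcs G k} {y : lcs G l}
    (hxy : (x : G)⁻¹ * (y : G) ∈ lcs G (k + 1)) : cls k x = cls l y := by
  subst h
  unfold cls
  rw [lcsQuot_mk_eq.mpr hxy]

theorem cls_conj {k : ℕ+} (x : lcs G k) (g : G) :
    cls k ⟨g * x * g⁻¹, (lcs_normal G k).conj_mem _ x.2 g⟩ = cls k x :=
  (cls_congr rfl (lcs_conj_mem x.2 g)).symm

@[elab_as_elim]
theorem ind {p : Gr G → Prop} (a : Gr G) (h0 : p 0) (hc : ∀ k (x : lcs G k), p (cls k x))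
    (ha : ∀ a b, p a → p b → p (a + b)) : p a := by
  refine DirectSum.induction_on (motive := p) a h0 ?_ ha
  intro k q
  induction q using QuotientGroup.induction_on with | _ x => exact hc k x

theorem add_lie' (a b c : Gr G) : ⁅a + b, c⁆ = ⁅a, c⁆ + ⁅b, c⁆ := by
  simp [bracket_def]

theorem lie_add' (a b c : Gr G) : ⁅a, b + c⁆ = ⁅a, b⁆ + ⁅a, c⁆ := by
  simp [bracket_def]

theorem zero_lie' (a : Gr G) : ⁅(0 : Gr G), a⁆ = 0 := by simp [bracket_def]

theorem lie_zero' (a : Gr G) : ⁅a, (0 : Gr G)⁆ = 0 := by simp [bracket_def]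

theorem neg_lie' (a b : Gr G) : ⁅-a, b⁆ = -⁅a, b⁆ := by simp [bracket_def]

theorem lie_neg' (a b : Gr G) : ⁅a, -b⁆ = -⁅a, b⁆ := by simp [bracket_def]

theorem lie_skew' (a b : Gr G) : ⁅a, b⁆ + ⁅b, a⁆ = 0 := by
  induction a using ind with
  | h0 => simp [zero_lie', lie_zero']
  | ha a a' h h' => rw [add_lie', lie_add', add_add_add_comm, h, h', add_zero]
  | hc k x =>
    induction b using ind with
    | h0 => simp [zero_lie', lie_zero']
    | ha b b' h h' => rw [add_lie', lie_add', add_add_add_comm, h, h', add_zero]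
    | hc l y =>
      rw [cls_bracket, cls_bracket, add_eq_zero_iff_eq_neg, ← cls_inv]
      refine cls_congr (add_comm k l) ?_
      convert one_mem (lcs G (k + l + 1)) using 1
      simp [lcsComm, commutatorElement_def, mul_assoc]

theorem lie_self' (a : Gr G) : ⁅a, a⁆ = 0 := by
  induction a using ind with
  | h0 => exact zero_lie' 0
  | hc k x =>
    rw [cls_bracket, ← cls_one (k + k)]
    congr 1
    apply Subtype.ext
    simp [lcsComm]
  | ha a b h h' =>
    rw [add_lie', lie_add', lie_add', h, h', zero_add, add_zero, lie_skew']

/-- The Jacobi identity for homogeneous elements, from the Hall-Witt identity. -/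
theorem jacobi_cls {k l m : ℕ+} (x : lcs G k) (y : lcs G l) (z : lcs G m) :
    ⁅⁅cls k x, cls l y⁆, cls m z⁆ + ⁅⁅cls l y, cls m z⁆, cls k x⁆ +
      ⁅⁅cls m z, cls k x⁆, cls l y⁆ = 0 := by
  have e : ∀ {k l m : ℕ+} (x : lcs G k) (y : lcs G l) (z : lcs G m),
      ⁅⁅cls k x, cls l y⁆, cls m z⁆ = -cls (k + l + m)
        ⟨(y : G)⁻¹ * (lcsComm (lcsComm x⁻¹ y)⁻¹ z⁻¹ : G) * ((y : G)⁻¹)⁻¹,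
          (lcs_normal G _).conj_mem _ (lcsComm (lcsComm x⁻¹ y)⁻¹ z⁻¹).2 _⟩ := by
    intro k l m x y z
    rw [cls_conj, ← cls_bracket, cls_inv, ← cls_bracket, cls_inv, cls_inv]
    simp [neg_lie', lie_neg']
  have f : ∀ {n n' : ℕ+} (h : n = n') (u : lcs G n), cls n u = cls n' ⟨(u : G), h ▸ u.2⟩ := by
    intro n n' h u
    subst h
    rfl
  rw [e, e, e, f (show l + m + k = k + l + m by rw [add_comm, add_assoc]),
    f (show m + k + l = k + l + m by rw [add_assoc, add_comm]), ← neg_add, ← neg_add,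
    ← cls_mul, ← cls_mul, neg_eq_zero, ← cls_one (k + l + m)]
  congr 1
  apply Subtype.ext
  simp [lcsComm, commutatorElement_def, mul_assoc]

theorem leibniz' (a b c : Gr G) : ⁅a, ⁅b, c⁆⁆ = ⁅⁅a, b⁆, c⁆ + ⁅b, ⁅a, c⁆⁆ := by
  have sk : ∀ u v : Gr G, ⁅u, v⁆ = -⁅v, u⁆ := fun u v => add_eq_zero_iff_eq_neg.mp (lie_skew' u v)
  induction a using ind with
  | h0 => simp [zero_lie', lie_zero']
  | ha a a' h h' => simp only [add_lie', lie_add', h, h']; abel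
  | hc k x =>
    induction b using ind with
    | h0 => simp [zero_lie', lie_zero']
    | ha b b' h h' => simp only [add_lie', lie_add', h, h']; abel
    | hc l y =>
      induction c using ind with
      | h0 => simp [lie_zero']
      | ha c c' h h' => simp only [lie_add', h, h']; abel
      | hc m z =>
        have j := jacobi_cls x y z
        rw [sk (cls k x), sk (cls l y) ⁅cls k x, cls m z⁆, sk (cls k x) (cls m z), neg_lie', neg_neg]
        rw [add_right_comm, add_eq_zero_iff_eq_neg] at j
        exact j.symm

end Gr

/-- The Lie bracket of `gr G` is the one induced by the group commutator. -/
instance : LieRing (Gr G) where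
  add_lie := Gr.add_lie'
  lie_add := Gr.lie_add'
  lie_self := Gr.lie_self'
  leibniz_lie := Gr.leibniz'

end GradedLie

/-! ### Germs of holomorphic functions and vector fields on `(ℂ, a)` -/

section Germs

/-- Functions that are holomorphic in a neighbourhood of `a`. -/
def holFun (a : ℂ) : Subalgebra ℂ (ℂ → ℂ) where
  carrier := {f | AnalyticAt ℂ f a}
  mul_mem' hf hg := AnalyticAt.mul hf hg
  add_mem' hf hg := AnalyticAt.add hf hg
  algebraMap_mem' c := by
    change AnalyticAt ℂ (fun _ => c) a
    exact analyticAt_const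

/-- The functions that vanish in a neighbourhood of `a`. -/
def vanishingIdeal (a : ℂ) : Ideal (holFun a) where
  carrier := {f | (f : ℂ → ℂ) =ᶠ[𝓝 a] 0}
  add_mem' {f g} hf hg := by
    filter_upwards [hf, hg] with t h1 h2
    simp [h1, h2]
  zero_mem' := by
    change (0 : ℂ → ℂ) =ᶠ[𝓝 a] 0
    exact EventuallyEq.rfl
  smul_mem' c f hf := by
    filter_upwards [hf] with t h1
    simp [h1]

/-- The algebra of germs at `a` of holomorphic functions. -/
def HolGerm (a : ℂ) : Type := holFun a ⧸ vanishingIdeal a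

namespace HolGerm

instance (a : ℂ) : CommRing (HolGerm a) := inferInstanceAs (CommRing (holFun a ⧸ vanishingIdeal a))

instance (a : ℂ) : Algebra ℂ (HolGerm a) :=
  inferInstanceAs (Algebra ℂ (holFun a ⧸ vanishingIdeal a))

variable {a : ℂ}

/-- The germ at `a` of a function holomorphic near `a`. -/
def mk (f : ℂ → ℂ) (hf : AnalyticAt ℂ f a) : HolGerm a :=
  Ideal.Quotient.mk (vanishingIdeal a) ⟨f, hf⟩

theorem mk_eq_mk {f g : ℂ → ℂ} {hf : AnalyticAt ℂ f a} {hg : AnalyticAt ℂ g a} :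
    mk f hf = mk g hg ↔ f =ᶠ[𝓝 a] g := by
  refine (Ideal.Quotient.mk_eq_mk_iff_sub_mem (I := vanishingIdeal a) ⟨f, hf⟩ ⟨g, hg⟩).trans ?_
  change f - g =ᶠ[𝓝 a] 0 ↔ _
  exact eventuallyEq_iff_sub.symm

theorem exists_rep (x : HolGerm a) : ∃ (f : ℂ → ℂ) (hf : AnalyticAt ℂ f a), x = mk f hf := by
  obtain ⟨⟨f, hf⟩, rfl⟩ := Ideal.Quotient.mk_surjective x
  exact ⟨f, hf, rfl⟩

/-- The derivative of a germ, computed on a representative. -/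
def derivFun (x : HolGerm a) : HolGerm a :=
  mk (deriv (exists_rep x).choose) (exists_rep x).choose_spec.choose.deriv

theorem derivFun_mk (f : ℂ → ℂ) (hf : AnalyticAt ℂ f a) :
    derivFun (mk f hf) = mk (deriv f) hf.deriv := by
  unfold derivFun
  rw [mk_eq_mk]
  exact (mk_eq_mk.mp (exists_rep (mk f hf)).choose_spec.choose_spec).symm.deriv

/-- The derivation `∂_t = d/dt` of the algebra of germs. -/
def del (a : ℂ) : Derivation ℂ (HolGerm a) (HolGerm a) :=
  Derivation.mk'
    { toFun := derivFun
      map_add' := by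
        intro x y
        obtain ⟨f, hf, rfl⟩ := exists_rep x
        obtain ⟨g, hg, rfl⟩ := exists_rep y
        change derivFun (mk (f + g) (hf.add hg)) = _
        rw [derivFun_mk, derivFun_mk, derivFun_mk]
        change _ = mk (deriv f + deriv g) (hf.deriv.add hg.deriv)
        rw [mk_eq_mk]
        filter_upwards [hf.eventually_analyticAt, hg.eventually_analyticAt] with t h1 h2
        exact deriv_add h1.differentiableAt h2.differentiableAt
      map_smul' := by
        intro c x
        obtain ⟨f, hf, rfl⟩ := exists_rep x
        change derivFun (mk (c • f) (hf.const_smul (c := c))) = _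
        rw [derivFun_mk, derivFun_mk]
        change _ = mk (c • deriv f) (hf.deriv.const_smul (c := c))
        rw [mk_eq_mk]
        filter_upwards [hf.eventually_analyticAt] with t h1
        exact deriv_const_smul c h1.differentiableAt }
    (by
      intro x y
      obtain ⟨f, hf, rfl⟩ := exists_rep x
      obtain ⟨g, hg, rfl⟩ := exists_rep y
      change derivFun (mk (f * g) (hf.mul hg)) = mk f hf * derivFun _ + mk g hg * derivFun _
      rw [derivFun_mk, derivFun_mk, derivFun_mk]
      change _ = mk (f * deriv g + g * deriv f) ((hf.mul hg.deriv).add (hg.mul hf.deriv))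
      rw [mk_eq_mk]
      filter_upwards [hf.eventually_analyticAt, hg.eventually_analyticAt] with t h1 h2
      rw [deriv_mul h1.differentiableAt h2.differentiableAt]
      simp only [Pi.add_apply, Pi.mul_apply]
      ring)

theorem del_mk (f : ℂ → ℂ) (hf : AnalyticAt ℂ f a) : del a (mk f hf) = mk (deriv f) hf.deriv :=
  derivFun_mk f hf

/-- The Wronskian `W(f, g) = f g' - f' g`. -/
def wronskian (f g : HolGerm a) : HolGerm a := f * del a g - del a f * g

end HolGerm

/-- The Lie algebra `𝔛(ℂ, a)` of germs at `a` of holomorphic vector fields `f ∂_t`, acting as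
derivations on germs of functions; the bracket is the commutator of derivations. -/
def VectorFieldGerm (a : ℂ) : LieSubalgebra ℂ (Derivation ℂ (HolGerm a) (HolGerm a)) where
  carrier := {D | ∃ f : HolGerm a, D = f • HolGerm.del a}
  add_mem' := by
    rintro _ _ ⟨f, rfl⟩ ⟨g, rfl⟩
    exact ⟨f + g, (add_smul f g _).symm⟩
  zero_mem' := ⟨0, (zero_smul _ _).symm⟩
  smul_mem' := by
    rintro c _ ⟨f, rfl⟩
    exact ⟨c • f, (smul_assoc c f _).symm⟩
  lie_mem' := by
    rintro _ _ ⟨f, rfl⟩ ⟨g, rfl⟩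
    refine ⟨HolGerm.wronskian f g, ?_⟩
    ext x
    simp only [Derivation.commutator_apply, Derivation.smul_apply, smul_eq_mul, Derivation.leibniz,
      HolGerm.wronskian]
    ring

/-- The germ of vector field `f ∂_t`. -/
def vectorField {a : ℂ} (f : HolGerm a) : VectorFieldGerm a := ⟨f • HolGerm.del a, f, rfl⟩

end Germs

/-! ### Holonomy of the deformation `dH + ε η = 0` -/

section Holonomy

/-- The fibre `{H = t₀}` in `ℂ²`. -/
abbrev Fiber (H : MvPolynomial (Fin 2) ℂ) (t₀ : ℂ) : Type := {z : Fin 2 → ℂ // eval z H = t₀}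

/-- `π₁(X, x)` with the convention that `α * β` is `α` followed by `β`
(Mathlib's `FundamentalGroup` multiplies in the opposite order). -/
abbrev PiOne (X : Type*) [TopologicalSpace X] (x : X) : Type _ := (FundamentalGroup X x)ᵐᵒᵖ

/-- The class in `π₁(X, x)` of a loop. -/
def loopClass {X : Type*} [TopologicalSpace X] {x : X} (γ : Path x x) : PiOne X x :=
  MulOpposite.op (FundamentalGroup.fromPath (Path.Homotopic.Quotient.mk γ))

theorem loopClass_mul {X : Type*} [TopologicalSpace X] {x : X} (α β : Path x x) :
    loopClass α * loopClass β = loopClass (α.trans β) := rfl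

variable (H : MvPolynomial (Fin 2) ℂ) (η : Fin 2 → MvPolynomial (Fin 2) ℂ)

/-- The coefficients at `z` of the one-form `dH + ε η`, where `η = η₀ dx₀ + η₁ dx₁`. -/
def deformedForm (ε : ℂ) (z : Fin 2 → ℂ) (i : Fin 2) : ℂ :=
  eval z (pderiv i H) + ε * eval z (η i)

/-- The partial derivative `∂F/∂x_i` of `F(ε, x₀, x₁)`. -/
def spaceDeriv (F : ℂ × (Fin 2 → ℂ) → ℂ) (i : Fin 2) (q : ℂ × (Fin 2 → ℂ)) : ℂ :=
  fderiv ℂ (fun z => F (q.1, z)) q.2 (Pi.single i 1)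

/-- `F(ε, ·)` is, for `ε` near `0` and near the point `z`, a holomorphic first integral of the
foliation `dH + ε η = 0`, depending holomorphically on `ε`: `dF_ε ∧ (dH + ε η) = 0`. -/
def IsFirstIntegralAt (F : ℂ × (Fin 2 → ℂ) → ℂ) (z : Fin 2 → ℂ) : Prop :=
  AnalyticAt ℂ F (0, z) ∧ ∀ᶠ q in 𝓝 ((0 : ℂ), z),
    spaceDeriv F 0 q * deformedForm H η q.1 q.2 1 = spaceDeriv F 1 q * deformedForm H η q.1 q.2 0

/-- `Γ` is a holomorphic transversal to the fibre at `p₀`, parametrized by the values of `H`. -/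
structure IsTransversal (Γ : ℂ → Fin 2 → ℂ) {t₀ : ℂ} (p₀ : Fiber H t₀) : Prop where
  analyticAt : AnalyticAt ℂ Γ t₀
  base : Γ t₀ = p₀
  param : ∀ᶠ t in 𝓝 t₀, eval (Γ t) H = t

variable (Γ : ℂ → Fin 2 → ℂ) {t₀ : ℂ} {p₀ : Fiber H t₀}

/-- `P(ε, t)` is the holonomy, from `Γ` to `Γ`, of the foliations `dH + ε η = 0` along the loop `γ`.
The transverse coordinate `F₁` of the leaves near the end of `γ`, normalized by `F₁(ε, Γ(t)) = t`,
is continued along `γ` as a first integral `F_s`; then the leaf that starts at `Γ(t)` and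
follows `γ` comes back to `Γ` at the point with parameter `P(ε, t) = F₀(ε, Γ(t))`. -/
def IsHolonomyAlong (γ : Path p₀ p₀) (P : ℂ × ℂ → ℂ) : Prop :=
  AnalyticAt ℂ P (0, t₀) ∧
  ∃ F : unitInterval → ℂ × (Fin 2 → ℂ) → ℂ,
    (∀ s, IsFirstIntegralAt H η (F s) (γ s)) ∧
    (∀ s, ∀ᶠ s' in 𝓝 s, F s' =ᶠ[𝓝 ((0 : ℂ), (γ s' : Fin 2 → ℂ))] F s) ∧
    (∀ᶠ x in 𝓝 ((0 : ℂ), t₀), F 1 (x.1, Γ x.2) = x.2) ∧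
    (∀ᶠ x in 𝓝 ((0 : ℂ), t₀), F 0 (x.1, Γ x.2) = P x)

open Classical in
/-- The holonomy map `P^δ(ε, t) = P^δ_ε(t)` of a class `δ` of loops: the germ at `(0, t₀)` of the
holonomy along any loop in the class. -/
def holonomy (δ : PiOne (Fiber H t₀) p₀) : ℂ × ℂ → ℂ :=
  if h : ∃ P : ℂ × ℂ → ℂ, ∃ γ : Path p₀ p₀, loopClass γ = δ ∧ IsHolonomyAlong H η Γ γ P
  then h.choose else Prod.snd

theorem holonomy_analyticAt (δ : PiOne (Fiber H t₀) p₀) :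
    AnalyticAt ℂ (holonomy H η Γ δ) (0, t₀) := by
  unfold holonomy
  split_ifs with h
  · obtain ⟨γ, -, h⟩ := h.choose_spec
    exact h.1
  · exact analyticAt_snd

/-- Taylor coefficients in `ε` at `ε = 0` of a holomorphic function are holomorphic in `t`. -/
theorem analyticAt_iteratedDeriv_fst {P : ℂ × ℂ → ℂ} {a : ℂ} (hP : AnalyticAt ℂ P (0, a)) (j : ℕ) :
    AnalyticAt ℂ (fun t => iteratedDeriv j (fun ε => P (ε, t)) 0) a := by
  have key : ∀ (j : ℕ) (P : ℂ × ℂ → ℂ), AnalyticAt ℂ P (0, a) →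
      AnalyticAt ℂ (fun x : ℂ × ℂ => iteratedDeriv j (fun ε => P (ε, x.2)) x.1) (0, a) := by
    intro j
    induction j with
    | zero => intro P hP; simpa using hP
    | succ j ih =>
      intro P hP
      have h1 : AnalyticAt ℂ (fun x : ℂ × ℂ => deriv (fun ε => P (ε, x.2)) x.1) (0, a) := by
        have h2 : AnalyticAt ℂ (fun x : ℂ × ℂ => fderiv ℂ P x (1, 0)) (0, a) :=
          ((ContinuousLinearMap.apply ℂ ℂ ((1, 0) : ℂ × ℂ)).analyticAt _).comp hP.fderiv
        refine h2.congr ?_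
        filter_upwards [hP.eventually_analyticAt] with x hx
        have h3 : HasDerivAt (fun ε : ℂ => (ε, x.2)) ((1, 0) : ℂ × ℂ) x.1 :=
          (hasDerivAt_id x.1).prodMk (hasDerivAt_const x.1 x.2)
        exact (hx.differentiableAt.hasFDerivAt.comp_hasDerivAt x.1 h3).deriv.symm
      simp only [iteratedDeriv_succ']
      exact ih _ h1
  exact (key j P hP).fun_comp (g := fun x : ℂ × ℂ => iteratedDeriv j (fun ε => P (ε, x.2)) x.1)
    (f := fun t : ℂ => ((0 : ℂ), t)) (analyticAt_const.prod analyticAt_id)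

/-- The Melnikov function `M_j^δ`, as a germ at `t₀`: the coefficient of `ε^j` in
`P^δ_ε(t) = t + ε M_1^δ(t) + ε² M_2^δ(t) + ⋯`. -/
def melnikov (j : ℕ) (δ : PiOne (Fiber H t₀) p₀) : HolGerm t₀ :=
  HolGerm.mk (fun t => (j.factorial : ℂ)⁻¹ * iteratedDeriv j (fun ε => holonomy H η Γ δ (ε, t)) 0)
    (analyticAt_const.mul (analyticAt_iteratedDeriv_fst (holonomy_analyticAt H η Γ δ) j))

/-- The leading vector field `v_{k,η}(δ) = M_k^δ ∂_t` of `δ ∈ L_k`. -/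
def leadingField (k : ℕ+) (δ : lcs (PiOne (Fiber H t₀) p₀) k) : VectorFieldGerm t₀ :=
  vectorField (melnikov H η Γ k (δ : PiOne (Fiber H t₀) p₀))

end Holonomy

end

/-! Let N be a first integral of `dH + ε η = 0` near a point of the fibre X = {H = t₀}, equal to H
at ε = 0. The map (ε, N) is a submersion whose fibres are the local leaves, so every first integral
near that point is g(ε, N) for a unique germ g at (0, t₀) (`IsNormalizedAt.exists_comp`,
`IsNormalizedAt.eventuallyEq_of_comp`). Such an N exists near every regular point
(`exists_isNormalizedAt`): follow the leaf to a coordinate line and take the value of H there.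

Hence the germs of first integrals along X form a covering of X with discrete fibre
(`integralBundle`), and the holonomy is its monodromy. Path lifting gives existence, connectedness
of the interval gives uniqueness, and homotopy lifting gives dependence on the homotopy class only
(`isHolonomyAlong_iff`). Since H continues itself along X, the holonomy is the identity at ε = 0
(`holonomy_zero`). Since continuation commutes with g(ε, ·), the holonomy of αβ is that of β
composed with that of α (`holonomy_mul`).

The rest concerns families tangent to the identity. If P = t + ε^k f + ⋯ and Q = t + ε^l g + ⋯, then
Q∘P - P∘Q = ε^(k+l) (f g' - f' g) + ⋯. No inverse is needed to pass to the commutator: [α, β](βα) =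
αβ says that Q∘P = (P∘Q)∘K, with K the holonomy of [α, β]. As P∘Q is the identity up to O(ε), the
displacement K - t is asymptotically equivalent to Q∘P - P∘Q (`IsTangentAt.commutator`).

So the elements with M_j = 0 for 0 < j < k form a subgroup N_k, with [N_k, N_l] inside N_{k+l}, and
M_k is additive on N_k. By induction L_k lies in N_k; therefore M_k is a homomorphism on L_k that
kills L_{k+1} and takes commutators to Wronskians. -/

noncomputable section

/-! ### Integration as an operator on continuous functions on the unit interval -/

section Primitive

open unitInterval

/-- The primitive vanishing at `0`, as a continuous linear operator on `C([0, 1], ℂ)`. -/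
def primitiveL : C(I, ℂ) →L[ℂ] C(I, ℂ) :=
  LinearMap.mkContinuous
    { toFun := fun φ =>
        ⟨fun τ => ∫ s in (0 : ℝ)..τ, φ (Set.projIcc 0 1 zero_le_one s), by
          have h : Continuous fun s : ℝ => φ (Set.projIcc 0 1 zero_le_one s) := by fun_prop
          exact (intervalIntegral.continuous_primitive (fun a b => h.intervalIntegrable a b) 0).comp
            continuous_subtype_val⟩
      map_add' := by
        intro φ χ
        ext τ
        have h : ∀ φ : C(I, ℂ), Continuous fun s : ℝ => φ (Set.projIcc 0 1 zero_le_one s) := by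
          intro φ; fun_prop
        exact intervalIntegral.integral_add ((h φ).intervalIntegrable _ _)
          ((h χ).intervalIntegrable _ _)
      map_smul' := by
        intro c φ
        ext τ
        exact intervalIntegral.integral_smul c _ } 1 (by
    intro φ
    rw [one_mul, ContinuousMap.norm_le _ (norm_nonneg _)]
    intro τ
    refine (intervalIntegral.norm_integral_le_of_norm_le_const
      (C := ‖φ‖) fun s _ => φ.norm_coe_le_norm _).trans ?_
    rw [sub_zero, abs_of_nonneg τ.2.1]
    exact mul_le_of_le_one_right (norm_nonneg _) τ.2.2)

theorem primitiveL_apply (φ : C(I, ℂ)) (τ : I) :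
    primitiveL φ τ = ∫ s in (0 : ℝ)..τ, φ (Set.projIcc 0 1 zero_le_one s) := rfl

theorem hasDerivAt_primitive (φ : C(I, ℂ)) (r : ℝ) :
    HasDerivAt (fun r : ℝ => ∫ s in (0 : ℝ)..r, φ (Set.projIcc 0 1 zero_le_one s))
      (φ (Set.projIcc 0 1 zero_le_one r)) r := by
  have h : Continuous fun s : ℝ => φ (Set.projIcc 0 1 zero_le_one s) := by fun_prop
  exact intervalIntegral.integral_hasDerivAt_right (h.intervalIntegrable _ _)
    (h.stronglyMeasurableAtFilter _ _) h.continuousAt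

/-- The affine map `τ ↦ r + τ (1 - r)` of the unit interval onto `[r, 1]`. -/
def tailMap (r τ : I) : I :=
  ⟨r + τ * (1 - r), by
    have := r.2.1; have := r.2.2; have := τ.2.1; have := τ.2.2
    constructor <;> nlinarith⟩

theorem continuous_tailMap : Continuous fun p : I × I => tailMap p.1 p.2 := by
  unfold tailMap
  fun_prop

/-- The part of a continuous function after the time `r`, reparametrized by the unit interval. -/
def tail (φ : C(I, ℂ)) (r : I) : C(I, ℂ) :=
  ⟨fun τ => φ (tailMap r τ), φ.continuous.comp
    (continuous_tailMap.comp (f := fun τ : I => (r, τ)) (by fun_prop))⟩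

theorem continuous_tail (φ : C(I, ℂ)) : Continuous (tail φ) :=
  (ContinuousMap.curry ⟨fun p : I × I => φ (tailMap p.1 p.2),
    φ.continuous.comp continuous_tailMap⟩).continuous

theorem tail_zero (φ : C(I, ℂ)) : tail φ 0 = φ := by
  ext τ
  simp [tail, tailMap]

/-- This is the affine substitution s ↦ r + (1 - r) s. The factor 1 - r stays on the left, so that r
= 1 is not a special case. -/
theorem primitiveL_tail (φ : C(I, ℂ)) (r τ : I) :
    (1 - (r : ℝ) : ℂ) * primitiveL (tail φ r) τ = primitiveL φ (tailMap r τ) - primitiveL φ r := by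
  have h : Continuous fun s : ℝ => φ (Set.projIcc 0 1 zero_le_one s) := by fun_prop
  have e : primitiveL (tail φ r) τ =
      ∫ s in (0 : ℝ)..τ, φ (Set.projIcc 0 1 zero_le_one ((r : ℝ) + (1 - r) * s)) := by
    rw [primitiveL_apply]
    refine intervalIntegral.integral_congr fun s hs => ?_
    rw [Set.uIcc_of_le τ.2.1] at hs
    have hs' : s ∈ Set.Icc (0 : ℝ) 1 := ⟨hs.1, hs.2.trans τ.2.2⟩
    have e1 : (r : ℝ) + (1 - r) * s = (tailMap r ⟨s, hs'⟩ : I) := by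
      simp only [tailMap]; ring
    simp only [tail, ContinuousMap.coe_mk]
    rw [e1, Set.projIcc_of_mem zero_le_one hs', Set.projIcc_val]
  have e2 := intervalIntegral.smul_integral_comp_add_mul
    (f := fun s : ℝ => φ (Set.projIcc 0 1 zero_le_one s)) (a := 0) (b := τ) (1 - (r : ℝ)) (r : ℝ)
  rw [e, primitiveL_apply, primitiveL_apply,
    intervalIntegral.integral_interval_sub_left (h.intervalIntegrable _ _)
      (h.intervalIntegrable _ _)]
  rw [Complex.real_smul] at e2
  push_cast at e2
  rw [e2]
  congr 1
  · simp
  · simp only [tailMap]; ring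

end Primitive

/-! ### The integral equation of the leaves, solved by the implicit function theorem -/

section LeafODE

open unitInterval

variable (H : MvPolynomial (Fin 2) ℂ) (η : Fin 2 → MvPolynomial (Fin 2) ℂ)

/-- The path with `i`-th coordinate `Y` whose other coordinate moves linearly from `z` to `a`. -/
def leafPath (a : Fin 2 → ℂ) (i : Fin 2) (z : Fin 2 → ℂ) (Y : C(I, ℂ)) (k : Fin 2) : C(I, ℂ) :=
  if k = i then Y else algebraMap ℂ _ (z k) + (a k - z k) • ⟨fun τ : I => ((τ : ℝ) : ℂ), by fun_prop⟩

/-- The coefficients of `dH + ε η` along a path. -/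
def formAlong (ε : ℂ) (p : Fin 2 → C(I, ℂ)) (k : Fin 2) : C(I, ℂ) :=
  aeval p (pderiv k H) + ε • aeval p (η k)

/-- The slope `dzᵢ/dzⱼ` along a path of the leaves of `dH + ε η = 0`. -/
def slopeAlong (i j : Fin 2) (ε : ℂ) (p : Fin 2 → C(I, ℂ)) : C(I, ℂ) :=
  -(formAlong H η ε p j * Ring.inverse (formAlong H η ε p i))

/-- The integral equation of the leaves of `dH + ε η = 0`, as graphs over the coordinate `j`. -/
def leafEq (a : Fin 2 → ℂ) (i j : Fin 2) (u : (ℂ × (Fin 2 → ℂ)) × C(I, ℂ)) : C(I, ℂ) :=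
  u.2 - algebraMap ℂ _ (u.1.2 i) -
    (a j - u.1.2 j) • primitiveL (slopeAlong H η i j u.1.1 (leafPath a i u.1.2 u.2))

theorem aeval_apply_unitInterval (p : Fin 2 → C(I, ℂ)) (q : MvPolynomial (Fin 2) ℂ) (τ : I) :
    (aeval p q : C(I, ℂ)) τ = eval (fun k => p k τ) q := by
  have h := MvPolynomial.comp_aeval_apply (f := p) (ContinuousMap.evalAlgHom ℂ ℂ τ) q
  simp only [ContinuousMap.evalAlgHom_apply] at h
  rw [h, MvPolynomial.aeval_eq_eval]

theorem formAlong_apply (ε : ℂ) (p : Fin 2 → C(I, ℂ)) (k : Fin 2) (τ : I) :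
    formAlong H η ε p k τ = deformedForm H η ε (fun k => p k τ) k := by
  simp [formAlong, deformedForm, aeval_apply_unitInterval]

theorem slopeAlong_apply (i j : Fin 2) (ε : ℂ) (p : Fin 2 → C(I, ℂ))
    (h : IsUnit (formAlong H η ε p i)) (τ : I) :
    slopeAlong H η i j ε p τ =
      -(deformedForm H η ε (fun k => p k τ) j / deformedForm H η ε (fun k => p k τ) i) := by
  obtain ⟨u, hu⟩ := h
  have h1 : (formAlong H η ε p i * Ring.inverse (formAlong H η ε p i)) τ = 1 := by
    rw [← hu, Ring.inverse_unit, Units.mul_inv]; rfl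
  rw [ContinuousMap.mul_apply, formAlong_apply] at h1
  have h2 : deformedForm H η ε (fun k => p k τ) i ≠ 0 := left_ne_zero_of_mul_eq_one h1
  simp only [slopeAlong, ContinuousMap.neg_apply, ContinuousMap.mul_apply, formAlong_apply]
  rw [eq_one_div_of_mul_eq_one_right h1]
  ring

variable {i j : Fin 2}

theorem analyticAt_formAlong (a : Fin 2 → ℂ) (k : Fin 2) (u : (ℂ × (Fin 2 → ℂ)) × C(I, ℂ)) :
    AnalyticAt ℂ (fun u : (ℂ × (Fin 2 → ℂ)) × C(I, ℂ) =>
      formAlong H η u.1.1 (leafPath a i u.1.2 u.2) k) u := by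
  have hz : ∀ k, AnalyticAt ℂ (fun u : (ℂ × (Fin 2 → ℂ)) × C(I, ℂ) => u.1.2 k) u := fun k =>
    (((ContinuousLinearMap.proj (R := ℂ) (φ := fun _ : Fin 2 => ℂ) k).comp
      (ContinuousLinearMap.snd ℂ ℂ (Fin 2 → ℂ))).comp
      (ContinuousLinearMap.fst ℂ (ℂ × (Fin 2 → ℂ)) C(I, ℂ))).analyticAt u
  have hp : ∀ k, AnalyticAt ℂ (fun u : (ℂ × (Fin 2 → ℂ)) × C(I, ℂ) =>
      leafPath a i u.1.2 u.2 k) u := by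
    intro k
    unfold leafPath
    split_ifs
    · exact analyticAt_snd
    · exact (((Algebra.linearMap ℂ C(I, ℂ)).mkContinuous 1
        (fun c => by simp [Algebra.linearMap_apply])).analyticAt _).fun_comp (hz k) |>.add
          ((analyticAt_const.sub (hz k)).smul analyticAt_const)
  unfold formAlong
  exact (AnalyticAt.aeval_mvPolynomial hp _).add
    ((analyticAt_fst.fun_comp analyticAt_fst).smul (AnalyticAt.aeval_mvPolynomial hp _))

/-- Apart from polynomials, the equation involves only inversion at a unit of the Banach algebra
`C(I, ℂ)` and the bounded operator `primitiveL`. -/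
theorem analyticAt_leafEq (a : Fin 2 → ℂ) (u : (ℂ × (Fin 2 → ℂ)) × C(I, ℂ))
    (hu : IsUnit (formAlong H η u.1.1 (leafPath a i u.1.2 u.2) i)) :
    AnalyticAt ℂ (leafEq H η a i j) u := by
  have hz : ∀ k, AnalyticAt ℂ (fun u : (ℂ × (Fin 2 → ℂ)) × C(I, ℂ) => u.1.2 k) u := fun k =>
    (((ContinuousLinearMap.proj (R := ℂ) (φ := fun _ : Fin 2 => ℂ) k).comp
      (ContinuousLinearMap.snd ℂ ℂ (Fin 2 → ℂ))).comp
      (ContinuousLinearMap.fst ℂ (ℂ × (Fin 2 → ℂ)) C(I, ℂ))).analyticAt u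
  have hs : AnalyticAt ℂ (fun u : (ℂ × (Fin 2 → ℂ)) × C(I, ℂ) =>
      slopeAlong H η i j u.1.1 (leafPath a i u.1.2 u.2)) u := by
    unfold slopeAlong
    refine ((analyticAt_formAlong H η a j u).mul ?_).neg
    obtain ⟨v, hv⟩ := hu
    have := analyticAt_inverse (𝕜 := ℂ) v
    rw [hv] at this
    exact this.fun_comp (f := fun u : (ℂ × (Fin 2 → ℂ)) × C(I, ℂ) =>
      formAlong H η u.1.1 (leafPath a i u.1.2 u.2) i) (analyticAt_formAlong H η a i u)
  unfold leafEq
  refine (analyticAt_snd.sub ?_).sub ((analyticAt_const.sub (hz j)).smul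
    ((primitiveL.analyticAt _).fun_comp hs))
  exact (((Algebra.linearMap ℂ C(I, ℂ)).mkContinuous 1
        (fun c => by simp [Algebra.linearMap_apply])).analyticAt _).fun_comp (hz i)

theorem leafPath_base (a : Fin 2 → ℂ) (i : Fin 2) :
    leafPath a i a (algebraMap ℂ _ (a i)) = fun k => algebraMap ℂ _ (a k) := by
  ext k τ
  unfold leafPath
  split_ifs with h
  · rw [h]
  · simp

theorem isUnit_formAlong_base {a : Fin 2 → ℂ} (hi : eval a (pderiv i H) ≠ 0) :
    IsUnit (formAlong H η 0 (leafPath a i a (algebraMap ℂ _ (a i))) i) := by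
  rw [leafPath_base, show formAlong H η 0 (fun k => algebraMap ℂ C(I, ℂ) (a k)) i =
    algebraMap ℂ _ (eval a (pderiv i H)) by
      ext τ
      rw [formAlong_apply]
      simp [deformedForm, Algebra.algebraMap_eq_smul_one]]
  exact (IsUnit.mk0 _ hi).map _

/-- The factor `a j - z j` vanishes at z = a and removes the integral. The equation is then affine
in Y with derivative the identity, which is the hypothesis of the implicit function theorem. -/
theorem leafEq_base (a : Fin 2 → ℂ) (Y : C(I, ℂ)) :
    leafEq H η a i j ((0, a), Y) = Y - algebraMap ℂ _ (a i) := by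
  ext τ
  simp [leafEq]

/-- The implicit function theorem in `C([0, 1], ℂ)` solves the equation of the leaves. -/
theorem exists_leaf (j : Fin 2) {a : Fin 2 → ℂ} (hi : eval a (pderiv i H) ≠ 0) :
    ∃ ψ : ℂ × (Fin 2 → ℂ) → C(I, ℂ), AnalyticAt ℂ ψ (0, a) ∧
      ψ (0, a) = algebraMap ℂ _ (a i) ∧
      (∀ᶠ q in 𝓝 ((0 : ℂ), a), leafEq H η a i j (q, ψ q) = 0) ∧
      (∀ᶠ q in 𝓝 ((0 : ℂ), a), IsUnit (formAlong H η q.1 (leafPath a i q.2 (ψ q)) i)) ∧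
      (∀ᶠ u in 𝓝 (((0 : ℂ), a), ψ (0, a)), leafEq H η a i j u = 0 → ψ u.1 = u.2) := by
  set u₀ : (ℂ × (Fin 2 → ℂ)) × C(I, ℂ) := ((0, a), algebraMap ℂ _ (a i)) with hu₀
  have h0 : leafEq H η a i j u₀ = 0 := by rw [hu₀, leafEq_base, sub_self]
  have han := analyticAt_leafEq H η (j := j) a u₀ (isUnit_formAlong_base H η hi)
  have hcd : ContDiffAt ℂ ⊤ (leafEq H η a i j) u₀ := han.contDiffAt
  have hn : (⊤ : WithTop ℕ∞) ≠ 0 := by simp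
  have hd : fderiv ℂ (leafEq H η a i j) u₀ ∘L .inr ℂ (ℂ × (Fin 2 → ℂ)) C(I, ℂ) =
      ContinuousLinearMap.id ℂ C(I, ℂ) := by
    have h1 : HasFDerivAt (fun Y : C(I, ℂ) => leafEq H η a i j ((0, a), Y))
        (fderiv ℂ (leafEq H η a i j) u₀ ∘L .inr ℂ (ℂ × (Fin 2 → ℂ)) C(I, ℂ)) u₀.2 :=
      HasFDerivAt.comp u₀.2 han.differentiableAt.hasFDerivAt (hasFDerivAt_prodMk_right _ _)
    simp only [leafEq_base] at h1
    exact h1.unique ((hasFDerivAt_id _).sub_const _)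
  have hinv : (fderiv ℂ (leafEq H η a i j) u₀ ∘L
      .inr ℂ (ℂ × (Fin 2 → ℂ)) C(I, ℂ)).IsInvertible := by
    rw [hd]; exact ⟨ContinuousLinearEquiv.refl ℂ _, rfl⟩
  have hψ := hcd.contDiffAt_implicitFunction hn hinv
  have hψ0 := hcd.implicitFunction_apply_self hn hinv
  refine ⟨hcd.implicitFunction hn hinv, hψ.analyticAt, hψ0, ?_, ?_, ?_⟩
  · filter_upwards [hcd.eventually_apply_implicitFunction hn hinv] with q hq
    rw [hq, h0]
  · have hc : ContinuousAt (fun q : ℂ × (Fin 2 → ℂ) =>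
        formAlong H η q.1 (leafPath a i q.2 (hcd.implicitFunction hn hinv q)) i) (0, a) :=
      ContinuousAt.comp (f := fun q : ℂ × (Fin 2 → ℂ) => (q, hcd.implicitFunction hn hinv q))
        (g := fun u : (ℂ × (Fin 2 → ℂ)) × C(I, ℂ) => formAlong H η u.1.1 (leafPath a i u.1.2 u.2) i)
        (analyticAt_formAlong H η a i _).continuousAt (continuousAt_id.prodMk hψ.continuousAt)
    refine hc.eventually (Units.isOpen.mem_nhds ?_)
    change IsUnit (formAlong H η 0 (leafPath a i a (hcd.implicitFunction hn hinv u₀.1)) i)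
    rw [hψ0]
    exact isUnit_formAlong_base H η hi
  -- Local uniqueness: it will show that the solution restarted at an intermediate point is the rest
  -- of the original one.
  · have h1 := hcd.eventually_apply_eq_iff_implicitFunction hn hinv
    change ∀ᶠ u in 𝓝 (u₀.1, hcd.implicitFunction hn hinv u₀.1), _
    rw [hψ0]
    filter_upwards [h1] with u hu h2
    exact hu.mp (h2.trans h0.symm)

end LeafODE

/-! ### Differentiation of polynomial functions -/

/-- The coordinate `z ↦ z k`, as a continuous linear form. -/
def coordL {σ : Type*} (k : σ) : (σ → ℂ) →L[ℂ] ℂ := ContinuousLinearMap.proj k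

theorem hasFDerivAt_eval {σ : Type*} [Fintype σ] (p : MvPolynomial σ ℂ) (z : σ → ℂ) :
    HasFDerivAt (fun z => eval z p)
      (∑ k, eval z (pderiv k p) • coordL k) z := by
  classical
  induction p using MvPolynomial.induction_on with
  | C c =>
    simp only [eval_C]
    refine (hasFDerivAt_const c z).congr_fderiv ?_
    ext v
    simp
  | add p q hp hq =>
    simp only [map_add]
    refine (hp.fun_add hq).congr_fderiv ?_
    ext v
    simp [Finset.sum_add_distrib, add_mul]
  | mul_X p k hp =>
    have hX : HasFDerivAt (fun z : σ → ℂ => z k) (coordL k) z := (coordL k).hasFDerivAt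
    have h := hp.fun_mul hX
    simp only [map_mul, eval_X]
    refine h.congr_fderiv ?_
    have e : ∀ x, eval z (pderiv x (p * X k)) =
        (if k = x then eval z p else 0) + z k * eval z (pderiv x p) := by
      intro x
      rw [Derivation.leibniz, pderiv_X, Pi.single_apply]
      split_ifs <;> simp
    ext v
    simp only [e]
    simp [Finset.sum_add_distrib, add_mul, ite_mul, Finset.mul_sum, mul_assoc]

theorem analyticAt_eval {σ : Type*} [Fintype σ] (p : MvPolynomial σ ℂ) (z : σ → ℂ) :
    AnalyticAt ℂ (fun z => eval z p) z := by
  have h := AnalyticAt.aeval_mvPolynomial (𝕜 := ℂ) (A := ℂ) (B := ℂ) (f := fun z : σ → ℂ => z)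
    (z := z) (fun i => (ContinuousLinearMap.proj (R := ℂ) (φ := fun _ : σ => ℂ) i).analyticAt z) p
  simpa only [MvPolynomial.aeval_eq_eval] using h

/-! ### Solutions of the leaf equation as curves, and their restarting -/

section LeafSolution

open unitInterval

theorem algebraMap_unitInterval_apply (c : ℂ) (τ : I) : algebraMap ℂ C(I, ℂ) c τ = c := by
  simp [Algebra.algebraMap_eq_smul_one]

variable {H : MvPolynomial (Fin 2) ℂ} {η : Fin 2 → MvPolynomial (Fin 2) ℂ}
variable {i j : Fin 2} {a z : Fin 2 → ℂ} {ε : ℂ} {Y : C(I, ℂ)}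

/-- The position at the real time `r`, on the leaf with slope `φ`, of the path from `z`. -/
def leafPos (a : Fin 2 → ℂ) (i j : Fin 2) (z : Fin 2 → ℂ) (φ : C(I, ℂ)) (r : ℝ) (k : Fin 2) : ℂ :=
  if k = i then z i + (a j - z j) * ∫ s in (0 : ℝ)..r, φ (Set.projIcc 0 1 zero_le_one s)
  else z k + (a k - z k) * r

/-- `leafPos` extends the solution to all real times, the slope being continued by constants outside
[0, 1], so that it has an ordinary derivative at the endpoints too. -/
theorem leafPos_eq (hY : leafEq H η a i j ((ε, z), Y) = 0) (r : I) (k : Fin 2) :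
    leafPath a i z Y k r =
      leafPos a i j z (slopeAlong H η i j ε (leafPath a i z Y)) r k := by
  unfold leafPos
  split_ifs with h
  · have h1 := congrArg (fun f : C(I, ℂ) => f r) hY
    simp only [leafEq, ContinuousMap.sub_apply, ContinuousMap.smul_apply, ContinuousMap.zero_apply,
      algebraMap_unitInterval_apply, smul_eq_mul] at h1
    rw [primitiveL_apply] at h1
    simp only [leafPath, if_pos h]
    linear_combination h1
  · simp [leafPath, if_neg h]

theorem leafPos_zero (φ : C(I, ℂ)) : leafPos a i j z φ 0 = z := by
  ext k
  unfold leafPos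
  split_ifs with h <;> simp [h]

theorem hasDerivAt_leafPos (hij : i ≠ j) (φ : C(I, ℂ)) (r : ℝ) :
    HasDerivAt (leafPos a i j z φ)
      ((a j - z j) • (Pi.single j 1 + φ (Set.projIcc 0 1 zero_le_one r) • Pi.single i 1)) r := by
  rw [hasDerivAt_pi]
  intro k
  unfold leafPos
  by_cases h : k = i
  · subst h
    simp only [if_true]
    refine (((hasDerivAt_primitive φ r).const_mul (a j - z j)).const_add (z k)).congr_deriv ?_
    simp [hij]
  · have hk : k = j := by omega
    subst hk
    simp only [if_neg h]
    refine (((Complex.ofRealCLM.hasDerivAt (x := r)).const_mul (a k - z k)).const_add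
      (z k)).congr_deriv ?_
    simp [h]

theorem leafPath_tail (Y : C(I, ℂ)) (r : I) (k : Fin 2) :
    leafPath a i (fun k => leafPath a i z Y k r) (tail Y r) k = tail (leafPath a i z Y k) r := by
  ext τ
  unfold leafPath
  split_ifs with h
  · rfl
  · simp [tail, tailMap, h]
    ring

/-- The end of a solution of the leaf equation is a solution. -/
theorem leafEq_tail (hij : i ≠ j) (hY : leafEq H η a i j ((ε, z), Y) = 0)
    (hu : IsUnit (formAlong H η ε (leafPath a i z Y) i)) (r : I) :
    leafEq H η a i j ((ε, fun k => leafPath a i z Y k r), tail Y r) = 0 := by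
  have hform : ∀ k τ, formAlong H η ε
      (leafPath a i (fun k => leafPath a i z Y k r) (tail Y r)) k τ =
      formAlong H η ε (leafPath a i z Y) k (tailMap r τ) := by
    intro k τ
    simp only [formAlong_apply, leafPath_tail]
    rfl
  have hu' : IsUnit (formAlong H η ε
      (leafPath a i (fun k => leafPath a i z Y k r) (tail Y r)) i) := by
    rw [ContinuousMap.isUnit_iff_forall_ne_zero] at hu ⊢
    intro τ
    rw [hform]
    exact hu _
  -- The slope depends only on the current position, so it restarts together with the path.
  have hslope : slopeAlong H η i j ε (leafPath a i (fun k => leafPath a i z Y k r) (tail Y r)) =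
      tail (slopeAlong H η i j ε (leafPath a i z Y)) r := by
    ext τ
    rw [slopeAlong_apply _ _ _ _ _ _ hu', ← formAlong_apply, ← formAlong_apply, hform, hform,
      formAlong_apply, formAlong_apply, ← slopeAlong_apply _ _ _ _ _ _ hu]
    rfl
  ext τ
  have h1 := leafPos_eq hY r i
  have h2 := leafPos_eq hY (tailMap r τ) i
  have h3 := primitiveL_tail (slopeAlong H η i j ε (leafPath a i z Y)) r τ
  simp only [leafPos, if_true, ← primitiveL_apply] at h1 h2
  simp only [leafEq, hslope, ContinuousMap.sub_apply, ContinuousMap.smul_apply,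
    ContinuousMap.zero_apply, algebraMap_unitInterval_apply, smul_eq_mul]
  have h4 : leafPath a i z Y j r = z j + (a j - z j) * r := by simp [leafPath, hij.symm]
  have h5 : (tail Y r) τ = leafPath a i z Y i (tailMap r τ) := by simp [leafPath, tail]
  rw [h4, h5, h2, h1]
  linear_combination (-(a j - z j)) * h3

end LeafSolution

/-! ### Existence of normalized first integrals near regular points -/

section LocalFirstIntegral

open unitInterval

variable {H : MvPolynomial (Fin 2) ℂ} {η : Fin 2 → MvPolynomial (Fin 2) ℂ}

/-- A first integral near `z` of the deformed foliation that equals `H` at `ε = 0`. -/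
def IsNormalizedAt (H : MvPolynomial (Fin 2) ℂ) (η : Fin 2 → MvPolynomial (Fin 2) ℂ)
    (F : ℂ × (Fin 2 → ℂ) → ℂ) (z : Fin 2 → ℂ) : Prop :=
  IsFirstIntegralAt H η F z ∧ ∀ᶠ w in 𝓝 z, F (0, w) = eval w H

theorem continuous_deformedForm (k : Fin 2) :
    Continuous fun q : ℂ × (Fin 2 → ℂ) => deformedForm H η q.1 q.2 k := by
  have h : ∀ p : MvPolynomial (Fin 2) ℂ, Continuous fun z : Fin 2 → ℂ => eval z p :=
    fun p => MvPolynomial.continuous_eval p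
  unfold deformedForm
  exact ((h _).comp continuous_snd).add (continuous_fst.mul ((h _).comp continuous_snd))

theorem spaceDeriv_eq {F : ℂ × (Fin 2 → ℂ) → ℂ} {q : ℂ × (Fin 2 → ℂ)}
    (h : DifferentiableAt ℂ F q) (k : Fin 2) :
    spaceDeriv F k q = fderiv ℂ F q (0, Pi.single k 1) := by
  unfold spaceDeriv
  have h1 : HasFDerivAt (fun z => F (q.1, z)) (fderiv ℂ F q ∘L .inr ℂ ℂ (Fin 2 → ℂ)) q.2 :=
    HasFDerivAt.comp q.2 h.hasFDerivAt (hasFDerivAt_prodMk_right _ _)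
  rw [h1.fderiv]
  rfl

theorem first_integral_eq_iff {F : ℂ × (Fin 2 → ℂ) → ℂ} {q : ℂ × (Fin 2 → ℂ)} {i j : Fin 2}
    (hij : i ≠ j) :
    spaceDeriv F 0 q * deformedForm H η q.1 q.2 1 = spaceDeriv F 1 q * deformedForm H η q.1 q.2 0 ↔
      spaceDeriv F j q * deformedForm H η q.1 q.2 i =
        spaceDeriv F i q * deformedForm H η q.1 q.2 j := by
  fin_cases i <;> fin_cases j <;> simp_all [eq_comm]

/-- The equation will come from differentiating along a path with speed `a j - z j`, which gives
nothing on the hyperplane z j = a j. That hyperplane has empty interior and both sides are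
continuous, so the equation extends to it. -/
theorem eventually_spaceDeriv_eq_of_ne {F : ℂ × (Fin 2 → ℂ) → ℂ} {a : Fin 2 → ℂ} {i j : Fin 2}
    (hF : AnalyticAt ℂ F (0, a))
    (h : ∀ᶠ q in 𝓝 ((0 : ℂ), a), q.2 j ≠ a j →
      spaceDeriv F j q * deformedForm H η q.1 q.2 i =
        spaceDeriv F i q * deformedForm H η q.1 q.2 j) :
    ∀ᶠ q in 𝓝 ((0 : ℂ), a), spaceDeriv F j q * deformedForm H η q.1 q.2 i =
        spaceDeriv F i q * deformedForm H η q.1 q.2 j := by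
  filter_upwards [h.eventually_nhds, hF.eventually_analyticAt] with q hq hFq
  have hc : ∀ k, ContinuousAt (spaceDeriv F k) q := by
    intro k
    have h1 : ContinuousAt (fun q => fderiv ℂ F q (0, Pi.single k 1)) q :=
      hFq.fderiv.continuousAt.clm_apply continuousAt_const
    refine h1.congr ?_
    filter_upwards [hFq.eventually_analyticAt] with x hx
    exact (spaceDeriv_eq hx.differentiableAt k).symm
  by_contra hne
  have hne' := (((hc j).mul (continuous_deformedForm i).continuousAt).ne_iff_eventually_ne
    ((hc i).mul (continuous_deformedForm j).continuousAt)).mp hne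
  have hconst : ∀ᶠ q' in 𝓝 q, q'.2 j = a j := by
    filter_upwards [hq, hne'] with q' h1 h2
    by_contra h3
    exact h2 (h1 h3)
  -- If the equation failed at q, a whole neighbourhood of q would lie in the hyperplane; a
  -- displacement in the direction j contradicts this.
  have ht : Tendsto (fun t : ℂ => (q.1, q.2 + t • Pi.single j (1 : ℂ))) (𝓝 0) (𝓝 q) := by
    have : Continuous fun t : ℂ => (q.1, q.2 + t • (Pi.single j (1 : ℂ) : Fin 2 → ℂ)) := by
      fun_prop
    simpa using this.tendsto 0
  have h4 : ∀ᶠ t : ℂ in 𝓝 0, q.2 j + t = a j := by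
    filter_upwards [ht.eventually hconst] with t h5
    simpa using h5
  have h6 : q.2 j = a j := by simpa using h4.self_of_nhds
  obtain ⟨t, h7, h8⟩ := ((h4.filter_mono nhdsWithin_le_nhds).and
    (self_mem_nhdsWithin (s := {(0 : ℂ)}ᶜ))).exists
  rw [h6] at h7
  exact h8 (by simpa using h7)

/-- The value of `H` on the transversal `zⱼ = aⱼ` of the leaf through a point. -/
def leafValue (H : MvPolynomial (Fin 2) ℂ) (a : Fin 2 → ℂ) (i : Fin 2)
    (ψ : ℂ × (Fin 2 → ℂ) → C(I, ℂ)) (q : ℂ × (Fin 2 → ℂ)) : ℂ :=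
  eval (Function.update a i (ψ q 1)) H

theorem analyticAt_leafValue {a : Fin 2 → ℂ} {i : Fin 2} {ψ : ℂ × (Fin 2 → ℂ) → C(I, ℂ)}
    {q : ℂ × (Fin 2 → ℂ)} (h : AnalyticAt ℂ ψ q) : AnalyticAt ℂ (leafValue H a i ψ) q := by
  refine (analyticAt_eval H _).comp (f := fun q => Function.update a i (ψ q 1)) ?_
  rw [analyticAt_pi_iff]
  intro k
  by_cases hk : k = i
  · subst hk
    simp only [Function.update_self]
    exact ((ContinuousMap.evalCLM ℂ (1 : I)).analyticAt _).comp h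
  · simp only [Function.update_of_ne hk]
    exact analyticAt_const

/-- At ε = 0 the slope is -∂ⱼH/∂ᵢH, so H has zero derivative along the path, which joins z to the
point where `leafValue` evaluates H. -/
theorem leafValue_eq_of_eps_zero {a z : Fin 2 → ℂ} {i j : Fin 2} (hij : i ≠ j)
    {ψ : ℂ × (Fin 2 → ℂ) → C(I, ℂ)} (hY : leafEq H η a i j ((0, z), ψ (0, z)) = 0)
    (hu : IsUnit (formAlong H η 0 (leafPath a i z (ψ (0, z))) i)) :
    leafValue H a i ψ (0, z) = eval z H := by
  set φ := slopeAlong H η i j 0 (leafPath a i z (ψ (0, z))) with hφ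
  have hd : ∀ r : ℝ, HasDerivAt (fun r : ℝ => eval (leafPos a i j z φ r) H) _ r := fun r =>
    (((hasFDerivAt_eval H (leafPos a i j z φ r)).restrictScalars ℝ).comp_hasDerivAt r
      (hasDerivAt_leafPos (a := a) (z := z) hij φ r))
  have hconst := constant_of_has_deriv_right_zero (a := 0) (b := 1)
    (f := fun r : ℝ => eval (leafPos a i j z φ r) H)
    (fun r _ => (hd r).continuousAt.continuousWithinAt) (fun r hr => by
      refine (hd r).hasDerivWithinAt.congr_deriv ?_
      have hr' : r ∈ Set.Icc (0 : ℝ) 1 := ⟨hr.1, hr.2.le⟩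
      have hform := formAlong_apply H η 0 (leafPath a i z (ψ (0, z))) i ⟨r, hr'⟩
      rw [ContinuousMap.isUnit_iff_forall_ne_zero] at hu
      have hne := hu ⟨r, hr'⟩
      rw [hform] at hne
      have hpos : (fun k => leafPath a i z (ψ (0, z)) k ⟨r, hr'⟩) = leafPos a i j z φ r := by
        ext k; exact leafPos_eq hY _ k
      have hs := slopeAlong_apply H η i j 0 (leafPath a i z (ψ (0, z)))
        ((ContinuousMap.isUnit_iff_forall_ne_zero _).mpr hu) ⟨r, hr'⟩
      rw [hpos] at hs hne
      rw [← hφ] at hs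
      rw [Set.projIcc_of_mem zero_le_one hr', hs]
      simp only [deformedForm, zero_mul, add_zero] at hne ⊢
      have hij' : (i = 0 ∧ j = 1) ∨ (i = 1 ∧ j = 0) := by omega
      rcases hij' with ⟨rfl, rfl⟩ | ⟨rfl, rfl⟩ <;>
      · simp [coordL]
        field_simp
        simp)
  have h1 := hconst 1 (by simp)
  simp only [leafPos_zero] at h1
  rw [← h1, leafValue]
  congr 2
  ext k
  have h2 := leafPos_eq hY 1 k
  simp only [Set.Icc.coe_one] at h2
  rw [← h2]
  unfold leafPath
  split_ifs with hk
  · subst hk; simp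
  · simp [Function.update_of_ne hk]

/-- For small r the restarted solution `tail Y r` is close to Y, hence is the one given by ψ, and it
has the same end as Y. So F is constant along the leaf, and its derivative in the direction eⱼ +
φ(0) eᵢ, where φ(0) = -Aⱼ/Aᵢ and A = dH + ε η at z, vanishes. -/
theorem leafValue_first_integral {a z : Fin 2 → ℂ} {ε : ℂ} {i j : Fin 2} (hij : i ≠ j)
    {ψ : ℂ × (Fin 2 → ℂ) → C(I, ℂ)} (hψ : AnalyticAt ℂ ψ (ε, z))
    (hY : leafEq H η a i j ((ε, z), ψ (ε, z)) = 0)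
    (hu : IsUnit (formAlong H η ε (leafPath a i z (ψ (ε, z))) i))
    (huniq : ∀ᶠ u in 𝓝 ((ε, z), ψ (ε, z)), leafEq H η a i j u = 0 → ψ u.1 = u.2)
    (hz : z j ≠ a j) :
    spaceDeriv (leafValue H a i ψ) j (ε, z) * deformedForm H η ε z i =
      spaceDeriv (leafValue H a i ψ) i (ε, z) * deformedForm H η ε z j := by
  set Y := ψ (ε, z) with hYdef
  set φ := slopeAlong H η i j ε (leafPath a i z Y) with hφ
  set F := leafValue H a i ψ with hF
  have hFd : DifferentiableAt ℂ F (ε, z) := (analyticAt_leafValue hψ).differentiableAt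
  have hpos : ∀ r : I, (fun k => leafPath a i z Y k r) = leafPos a i j z φ r := by
    intro r; ext k; exact leafPos_eq hY _ k
  -- the value is constant along the leaf
  have hpc : Continuous fun r : ℝ => leafPos a i j z φ r :=
    continuous_iff_continuousAt.mpr fun r => (hasDerivAt_leafPos (a := a) (z := z) hij φ r).continuousAt
  have htend : Tendsto (fun r : I => ((ε, leafPos a i j z φ r), tail Y r)) (𝓝 0)
      (𝓝 ((ε, z), Y)) := by
    have hc : Continuous fun r : I => ((ε, leafPos a i j z φ r), tail Y r) :=
      (continuous_const.prodMk (hpc.comp continuous_subtype_val)).prodMk (continuous_tail Y)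
    have := hc.tendsto 0
    simpa [leafPos_zero, tail_zero] using this
  have hconst : ∀ᶠ r : I in 𝓝 0, F (ε, leafPos a i j z φ r) = F (ε, z) := by
    filter_upwards [htend.eventually huniq] with r hr
    have h1 := leafEq_tail hij hY hu r
    rw [hpos] at h1
    have h2 := hr h1
    simp only [hF, leafValue]
    rw [h2, ← hYdef]
    simp [tail, tailMap]
  -- Constancy is known for times in [0, 1] only, so the derivative at 0 is compared within this
  -- interval, where it is still unique.
  have hconst' : (fun r : ℝ => F (ε, leafPos a i j z φ r)) =ᶠ[𝓝[Set.Icc 0 1] (0 : ℝ)]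
      fun _ => F (ε, z) := by
    have h0 : (0 : ℝ) = ((0 : I) : ℝ) := rfl
    rw [h0, nhdsWithin_eq_map_subtype_coe (by simp)]
    exact hconst
  have hd : HasDerivAt (fun r : ℝ => F (ε, leafPos a i j z φ r))
      (fderiv ℂ F (ε, z) (0, (a j - z j) • (Pi.single j 1 + φ 0 • Pi.single i 1))) 0 := by
    have h1 := (hasDerivAt_const (0 : ℝ) ε).prodMk (hasDerivAt_leafPos (a := a) (z := z) hij φ 0)
    rw [Set.projIcc_left] at h1
    have h2 : HasFDerivAt F (fderiv ℂ F (ε, z)) (ε, leafPos a i j z φ 0) := by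
      rw [leafPos_zero]; exact hFd.hasFDerivAt
    exact (h2.restrictScalars ℝ).comp_hasDerivAt (0 : ℝ) h1
  have hzero : fderiv ℂ F (ε, z) (0, (a j - z j) • (Pi.single j 1 + φ 0 • Pi.single i 1)) = 0 := by
    have hw := hd.hasDerivWithinAt (s := Set.Icc 0 1)
    have hw0 : HasDerivWithinAt (fun r : ℝ => F (ε, leafPos a i j z φ r)) 0 (Set.Icc 0 1) 0 :=
      (hasDerivWithinAt_const (0 : ℝ) (Set.Icc 0 1) (F (ε, z))).congr_of_eventuallyEq hconst'
        (by rw [leafPos_zero])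
    exact (uniqueDiffOn_Icc_zero_one 0 (by simp)).eq_deriv _ hw hw0
  have hlin : ((0 : ℂ), (a j - z j) • ((Pi.single j 1 : Fin 2 → ℂ) + φ 0 • Pi.single i 1)) =
      (a j - z j) • ((0, Pi.single j 1) + φ 0 • (0, Pi.single i 1)) := by
    ext k <;> simp [mul_add]
  rw [hlin, map_smul, map_add, map_smul, ← spaceDeriv_eq hFd, ← spaceDeriv_eq hFd, smul_eq_mul,
    smul_eq_mul] at hzero
  have h3 := (mul_eq_zero.mp hzero).resolve_left (sub_ne_zero.mpr hz.symm)
  have hs := slopeAlong_apply H η i j ε (leafPath a i z Y) hu 0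
  rw [ContinuousMap.isUnit_iff_forall_ne_zero] at hu
  have hne := hu 0
  rw [formAlong_apply] at hne
  have hp0 := hpos 0
  simp only [Set.Icc.coe_zero, leafPos_zero] at hp0
  rw [hp0] at hs hne
  rw [hφ, hs] at h3
  field_simp at h3
  linear_combination h3

/-- Near a regular point of `H` the deformed foliations have a normalized first integral. -/
theorem exists_isNormalizedAt (η : Fin 2 → MvPolynomial (Fin 2) ℂ) {a : Fin 2 → ℂ} {i : Fin 2}
    (hi : eval a (pderiv i H) ≠ 0) : ∃ F, IsNormalizedAt H η F a := by
  obtain ⟨j, hij⟩ : ∃ j, i ≠ j := ⟨1 - i, by omega⟩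
  obtain ⟨ψ, hψ, hψ0, hsol, hunit, huniq⟩ := exists_leaf H η j hi
  have hFan : AnalyticAt ℂ (leafValue H a i ψ) (0, a) := analyticAt_leafValue hψ
  refine ⟨leafValue H a i ψ, ⟨hFan, ?_⟩, ?_⟩
  -- The uniqueness near (0, a) spreads to the nearby points of the graph of ψ.
  · have huniq' : ∀ᶠ q in 𝓝 ((0 : ℂ), a),
        ∀ᶠ u in 𝓝 (q, ψ q), leafEq H η a i j u = 0 → ψ u.1 = u.2 :=
      (continuousAt_id.prodMk hψ.continuousAt).eventually huniq.eventually_nhds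
    have h := eventually_spaceDeriv_eq_of_ne (H := H) (η := η) (i := i) (j := j) hFan (by
      filter_upwards [hsol, hunit, huniq', hψ.eventually_analyticAt] with q h1 h2 h3 h4 h5
      exact leafValue_first_integral hij h4 h1 h2 h3 h5)
    filter_upwards [h] with q hq
    exact (first_integral_eq_iff hij).mpr hq
  · have ht : Tendsto (fun w : Fin 2 → ℂ => ((0 : ℂ), w)) (𝓝 a) (𝓝 (0, a)) :=
      (Continuous.prodMk_right (0 : ℂ)).tendsto a
    filter_upwards [ht.eventually hsol, ht.eventually hunit] with w h1 h2
    exact leafValue_eq_of_eps_zero hij h1 h2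

end LocalFirstIntegral

/-! ### The analytic inverse function theorem -/

section Inverse

/-- The analytic inverse function theorem in finite dimension. -/
theorem exists_analytic_inverse {E : Type*} [NormedAddCommGroup E] [NormedSpace ℂ E]
    [FiniteDimensional ℂ E] {χ : E → E} {x : E} (h : AnalyticAt ℂ χ x)
    (hinj : ∀ v, fderiv ℂ χ x v = 0 → v = 0) :
    ∃ κ : E → E, AnalyticAt ℂ κ (χ x) ∧ κ (χ x) = x ∧ (∀ᶠ y in 𝓝 x, κ (χ y) = y) ∧
      ∀ᶠ y in 𝓝 (χ x), χ (κ y) = y := by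
  have : CompleteSpace E := FiniteDimensional.complete ℂ E
  have hker : LinearMap.ker (fderiv ℂ χ x : E →ₗ[ℂ] E) = ⊥ :=
    LinearMap.ker_eq_bot'.mpr hinj
  let e : E ≃L[ℂ] E :=
    (LinearEquiv.ofInjectiveEndo (fderiv ℂ χ x : E →ₗ[ℂ] E)
      (LinearMap.ker_eq_bot.mp hker)).toContinuousLinearEquiv
  have he : (e : E →L[ℂ] E) = fderiv ℂ χ x := by
    ext v; rfl
  have hcd : ContDiffAt ℂ ⊤ χ x := h.contDiffAt
  have hd : HasFDerivAt χ (e : E →L[ℂ] E) x := by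
    rw [he]; exact h.differentiableAt.hasFDerivAt
  have hn : (⊤ : WithTop ℕ∞) ≠ 0 := by simp
  have hs := hcd.hasStrictFDerivAt' hd hn
  exact ⟨hcd.localInverse hd hn, (hcd.to_localInverse hd hn).analyticAt,
    hcd.localInverse_apply_image hd hn, hs.eventually_left_inverse, hs.eventually_right_inverse⟩

end Inverse

/-! ### First integrals as functions of ε and a normalized first integral -/

section Structure

variable {H : MvPolynomial (Fin 2) ℂ} {η : Fin 2 → MvPolynomial (Fin 2) ℂ}
variable {F G : ℂ × (Fin 2 → ℂ) → ℂ} {z : Fin 2 → ℂ}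

/-- An analytic function equal to `H` at `ε = 0` has the derivatives of `H` in the space variables. -/
theorem fderiv_of_eq_eval (hF : AnalyticAt ℂ F (0, z)) (h : ∀ᶠ w in 𝓝 z, F (0, w) = eval w H)
    (k : Fin 2) : fderiv ℂ F (0, z) (0, Pi.single k 1) = eval z (pderiv k H) := by
  rw [← spaceDeriv_eq hF.differentiableAt]
  unfold spaceDeriv
  have h' : (fun w => F (0, w)) =ᶠ[𝓝 z] fun w => eval w H := h
  simp only [h'.fderiv_eq, (hasFDerivAt_eval H z).fderiv]
  fin_cases k <;> simp [coordL]

theorem IsFirstIntegralAt.eventually (hF : IsFirstIntegralAt H η F z) :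
    ∀ᶠ w in 𝓝 z, IsFirstIntegralAt H η F w := by
  have ht : Tendsto (fun w : Fin 2 → ℂ => ((0 : ℂ), w)) (𝓝 z) (𝓝 (0, z)) :=
    (Continuous.prodMk_right (0 : ℂ)).tendsto z
  filter_upwards [ht.eventually hF.1.eventually_analyticAt, ht.eventually hF.2.eventually_nhds]
    with w h1 h2
  exact ⟨h1, h2⟩

theorem IsNormalizedAt.eventually (hF : IsNormalizedAt H η F z) :
    ∀ᶠ w in 𝓝 z, IsNormalizedAt H η F w := by
  filter_upwards [hF.1.eventually, hF.2.eventually_nhds] with w h1 h2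
  exact ⟨h1, h2⟩

theorem IsNormalizedAt.apply_zero (hF : IsNormalizedAt H η F z) : F (0, z) = eval z H :=
  hF.2.self_of_nhds

/-- A function of `ε` and a first integral is a first integral. -/
theorem IsFirstIntegralAt.comp (hF : IsFirstIntegralAt H η F z) {g : ℂ × ℂ → ℂ}
    (hg : AnalyticAt ℂ g (0, F (0, z))) : IsFirstIntegralAt H η (fun q => g (q.1, F q)) z := by
  have hmap : AnalyticAt ℂ (fun q : ℂ × (Fin 2 → ℂ) => (q.1, F q)) (0, z) :=
    analyticAt_fst.prod hF.1
  have hgF : AnalyticAt ℂ (fun q => g (q.1, F q)) (0, z) :=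
    AnalyticAt.fun_comp (g := g) (f := fun q : ℂ × (Fin 2 → ℂ) => (q.1, F q)) hg hmap
  refine ⟨hgF, ?_⟩
  have hga : ∀ᶠ q in 𝓝 ((0 : ℂ), z), AnalyticAt ℂ g (q.1, F q) :=
    hmap.continuousAt.eventually hg.eventually_analyticAt
  filter_upwards [hF.2, hF.1.eventually_analyticAt, hgF.eventually_analyticAt, hga]
    with q h1 h2 h3 h4
  have e : ∀ k, spaceDeriv (fun q => g (q.1, F q)) k q =
      fderiv ℂ g (q.1, F q) (0, 1) * spaceDeriv F k q := by
    intro k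
    rw [spaceDeriv_eq h3.differentiableAt, spaceDeriv_eq h2.differentiableAt]
    have h5 : HasFDerivAt (fun q => g (q.1, F q)) (fderiv ℂ g (q.1, F q) ∘L
        ((ContinuousLinearMap.fst ℂ ℂ (Fin 2 → ℂ)).prod (fderiv ℂ F q))) q :=
      HasFDerivAt.comp (g := g) (f := fun q : ℂ × (Fin 2 → ℂ) => (q.1, F q)) q
        h4.differentiableAt.hasFDerivAt
        (hasFDerivAt_fst.prodMk h2.differentiableAt.hasFDerivAt)
    rw [h5.fderiv]
    simp only [ContinuousLinearMap.comp_apply, ContinuousLinearMap.prod_apply,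
      ContinuousLinearMap.coe_fst']
    have h6 : ((0 : ℂ), fderiv ℂ F q (0, Pi.single k 1)) =
        fderiv ℂ F q (0, Pi.single k 1) • ((0 : ℂ), (1 : ℂ)) := by simp
    rw [h6, map_smul, smul_eq_mul, mul_comm]
  rw [e, e]
  linear_combination (fderiv ℂ g (q.1, F q) (0, 1)) * h1

/-- The straightening coordinates given by a normalized first integral. -/
def straighten (F : ℂ × (Fin 2 → ℂ) → ℂ) (i : Fin 2) (q : ℂ × (Fin 2 → ℂ)) : ℂ × (Fin 2 → ℂ) :=
  (q.1, Function.update q.2 i (F q))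

theorem analyticAt_straighten {q : ℂ × (Fin 2 → ℂ)} (hF : AnalyticAt ℂ F q) (i : Fin 2) :
    AnalyticAt ℂ (straighten F i) q := by
  refine analyticAt_fst.prod ?_
  rw [analyticAt_pi_iff]
  intro k
  by_cases hk : k = i
  · subst hk
    simpa only [Function.update_self] using hF
  · simp only [Function.update_of_ne hk]
    exact ((coordL k ∘L ContinuousLinearMap.snd ℂ ℂ (Fin 2 → ℂ)).analyticAt q)

theorem fderiv_straighten {q : ℂ × (Fin 2 → ℂ)} (hF : DifferentiableAt ℂ F q) (i : Fin 2)
    (v : ℂ × (Fin 2 → ℂ)) :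
    fderiv ℂ (straighten F i) q v = (v.1, Function.update v.2 i (fderiv ℂ F q v)) := by
  have h2 : HasFDerivAt (fun q : ℂ × (Fin 2 → ℂ) => Function.update q.2 i (F q))
      (ContinuousLinearMap.pi fun k => if k = i then fderiv ℂ F q
        else coordL k ∘L ContinuousLinearMap.snd ℂ ℂ (Fin 2 → ℂ)) q := by
    rw [hasFDerivAt_pi]
    intro k
    split_ifs with hk
    · subst hk
      simpa only [Function.update_self] using hF.hasFDerivAt
    · simp only [Function.update_of_ne hk]
      exact ((coordL k ∘L ContinuousLinearMap.snd ℂ ℂ (Fin 2 → ℂ)).hasFDerivAt)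
  have h3 : HasFDerivAt (straighten F i) _ q := hasFDerivAt_fst.prodMk h2
  rw [h3.fderiv]
  ext k
  · rfl
  · by_cases hk : k = i
    · subst hk; simp
    · simp [hk, coordL]

/-- A vector of the kernel can only have an i-th component, and on that one the derivative is
multiplication by ∂F/∂zᵢ ≠ 0. -/
theorem fderiv_straighten_injective (hF : AnalyticAt ℂ F (0, z)) {i : Fin 2}
    (hi : fderiv ℂ F (0, z) (0, Pi.single i 1) ≠ 0) (v : ℂ × (Fin 2 → ℂ))
    (hv : fderiv ℂ (straighten F i) (0, z) v = 0) : v = 0 := by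
  rw [fderiv_straighten hF.differentiableAt] at hv
  have h1 : v.1 = 0 := congrArg Prod.fst hv
  have h2 := congrArg Prod.snd hv
  have h3 : v = v.2 i • ((0 : ℂ), (Pi.single i 1 : Fin 2 → ℂ)) := by
    ext k
    · simpa using h1
    · by_cases hk : k = i
      · subst hk; simp
      · have := congrFun h2 k
        simpa [hk] using this
  have h4 : fderiv ℂ F (0, z) v = 0 := by simpa using congrFun h2 i
  rw [h3, map_smul, smul_eq_mul] at h4
  rw [h3, (mul_eq_zero.mp h4).resolve_right hi, zero_smul]

/-- An analytic function with vanishing `j`-th derivative does not depend on the coordinate `j`. -/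
theorem eventually_eq_update {u : ℂ × (Fin 2 → ℂ) → ℂ} {y₀ : ℂ × (Fin 2 → ℂ)} (j : Fin 2)
    (hu : AnalyticAt ℂ u y₀) (h : ∀ᶠ y in 𝓝 y₀, fderiv ℂ u y (0, Pi.single j 1) = 0) :
    ∀ᶠ y in 𝓝 y₀, u y = u (y.1, Function.update y.2 j (y₀.2 j)) := by
  obtain ⟨r, hr, hball⟩ := Metric.eventually_nhds_iff_ball.mp (h.and hu.eventually_analyticAt)
  filter_upwards [Metric.ball_mem_nhds y₀ hr] with y hy
  have hmem : ∀ s ∈ Metric.ball (y₀.2 j) r, (y.1, Function.update y.2 j s) ∈ Metric.ball y₀ r := by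
    intro s hs
    rw [Metric.mem_ball] at *
    rw [Prod.dist_eq, max_lt_iff] at *
    refine ⟨hy.1, ?_⟩
    rw [dist_pi_lt_iff hr] at *
    intro k
    by_cases hk : k = j
    · subst hk; simpa using hs
    · simpa [hk] using hy.2 k
  have hder : ∀ s ∈ Metric.ball (y₀.2 j) r,
      HasDerivAt (fun s => u (y.1, Function.update y.2 j s)) 0 s := by
    intro s hs
    obtain ⟨h1, h2⟩ := hball _ (hmem s hs)
    have h3 : HasDerivAt (fun s : ℂ => (y.1, Function.update y.2 j s))
        ((0 : ℂ), (Pi.single j 1 : Fin 2 → ℂ)) s :=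
      (hasDerivAt_const s y.1).prodMk (hasDerivAt_update y.2 j s)
    have h4 := h2.differentiableAt.hasFDerivAt.comp_hasDerivAt s h3
    rw [h1] at h4
    exact h4
  have hyj : y.2 j ∈ Metric.ball (y₀.2 j) r := by
    rw [Metric.mem_ball] at *
    rw [Prod.dist_eq, max_lt_iff] at hy
    exact (dist_le_pi_dist _ _ j).trans_lt hy.2
  have hc := Metric.isOpen_ball.is_const_of_deriv_eq_zero
    (convex_ball (y₀.2 j) r).isPreconnected
    (fun s hs => (hder s hs).differentiableAt.differentiableWithinAt)
    (fun s hs => (hder s hs).deriv) hyj (Metric.mem_ball_self hr)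
  simpa using hc

/-- Every first integral is a function of `ε` and a normalized first integral. -/
theorem IsNormalizedAt.exists_comp (hF : IsNormalizedAt H η F z)
    (hreg : ∃ i, eval z (pderiv i H) ≠ 0) (hG : IsFirstIntegralAt H η G z) :
    ∃ g : ℂ × ℂ → ℂ, AnalyticAt ℂ g (0, eval z H) ∧
      G =ᶠ[𝓝 (0, z)] fun q => g (q.1, F q) := by
  obtain ⟨i, hi⟩ := hreg
  obtain ⟨j, hij⟩ : ∃ j, i ≠ j := ⟨1 - i, by omega⟩
  have hFi : fderiv ℂ F (0, z) (0, Pi.single i 1) ≠ 0 := by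
    rwa [fderiv_of_eq_eval hF.1.1 hF.2]
  obtain ⟨κ, hκ, hκ0, hκl, hκr⟩ := exists_analytic_inverse (analyticAt_straighten hF.1.1 i)
    (fderiv_straighten_injective hF.1.1 hFi)
  have hχ0 : straighten F i (0, z) = (0, Function.update z i (eval z H)) := by
    simp [straighten, hF.apply_zero]
  have hu : AnalyticAt ℂ (fun y => G (κ y)) (straighten F i (0, z)) :=
    AnalyticAt.fun_comp (g := G) (by rw [hκ0]; exact hG.1) hκ
  have hA : ∀ᶠ q in 𝓝 ((0 : ℂ), z), deformedForm H η q.1 q.2 i ≠ 0 := by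
    refine (continuous_deformedForm (H := H) (η := η) i).continuousAt.eventually_ne ?_
    simpa [deformedForm] using hi
  have hcomp : ∀ᶠ q in 𝓝 ((0 : ℂ), z), ∀ᶠ q' in 𝓝 q, G (κ (straighten F i q')) = G q' := by
    filter_upwards [hκl.eventually_nhds] with q hq
    filter_upwards [hq] with q' hq'
    rw [hq']
  have huq : ∀ᶠ q in 𝓝 ((0 : ℂ), z), AnalyticAt ℂ (fun y => G (κ y)) (straighten F i q) :=
    (analyticAt_straighten hF.1.1 i).continuousAt.eventually hu.eventually_analyticAt
  -- The vector A eⱼ - B eᵢ is tangent to the leaf, so the differentials of F and G kill it.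
  -- Straightening has F as its i-th coordinate and so maps it to A eⱼ; since A ≠ 0, G in the
  -- straightened coordinates has zero j-th derivative.
  have hder : ∀ᶠ q in 𝓝 ((0 : ℂ), z),
      fderiv ℂ (fun y => G (κ y)) (straighten F i q) (0, Pi.single j 1) = 0 := by
    filter_upwards [hA, hcomp, huq, hF.1.2, hG.2, hF.1.1.eventually_analyticAt,
      hG.1.eventually_analyticAt] with q h1 h2 h3 h4 h5 h6 h7
    rw [first_integral_eq_iff hij, spaceDeriv_eq h6.differentiableAt,
      spaceDeriv_eq h6.differentiableAt] at h4
    rw [first_integral_eq_iff hij, spaceDeriv_eq h7.differentiableAt,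
      spaceDeriv_eq h7.differentiableAt] at h5
    have h8 := HasFDerivAt.comp q h3.differentiableAt.hasFDerivAt
      (analyticAt_straighten h6 i).differentiableAt.hasFDerivAt
    have h9 := (h8.congr_of_eventuallyEq (EventuallyEq.symm h2)).fderiv
    set A := deformedForm H η q.1 q.2 i with hAdef
    set B := deformedForm H η q.1 q.2 j with hBdef
    have hlin : ∀ L : ℂ × (Fin 2 → ℂ) →L[ℂ] ℂ,
        L (0, A • Pi.single j 1 - B • Pi.single i 1) =
          A * L (0, Pi.single j 1) - B * L (0, Pi.single i 1) := by
      intro L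
      rw [show ((0 : ℂ), A • (Pi.single j 1 : Fin 2 → ℂ) - B • Pi.single i 1) =
        A • (0, Pi.single j 1) - B • (0, Pi.single i 1) by simp,
        map_sub, map_smul, map_smul, smul_eq_mul, smul_eq_mul]
    have hF0 : fderiv ℂ F q (0, A • Pi.single j 1 - B • Pi.single i 1) = 0 := by
      rw [hlin]; linear_combination h4
    have hG0 : fderiv ℂ G q (0, A • Pi.single j 1 - B • Pi.single i 1) = 0 := by
      rw [hlin]; linear_combination h5
    rw [h9, ContinuousLinearMap.comp_apply, fderiv_straighten h6.differentiableAt, hF0] at hG0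
    rw [show ((0 : ℂ), Function.update (A • (Pi.single j 1 : Fin 2 → ℂ) - B • Pi.single i 1) i 0) =
      A • ((0 : ℂ), (Pi.single j 1 : Fin 2 → ℂ)) by
        ext k
        · simp
        · by_cases hk : k = i
          · subst hk; simp [hij]
          · simp [hk], map_smul, smul_eq_mul] at hG0
    exact (mul_eq_zero.mp hG0).resolve_left h1
  have hder' : ∀ᶠ y in 𝓝 (straighten F i (0, z)),
      fderiv ℂ (fun y => G (κ y)) y (0, Pi.single j 1) = 0 := by
    have hκt : Tendsto κ (𝓝 (straighten F i (0, z))) (𝓝 (0, z)) := by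
      have := hκ.continuousAt.tendsto
      rwa [hκ0] at this
    filter_upwards [hκt.eventually hder, hκr] with y h1 h2
    rwa [h2] at h1
  have hindep := eventually_eq_update j hu hder'
  -- In straightened coordinates G depends only on ε and the i-th slot, so the j-th slot may be
  -- frozen at `z j`.
  refine ⟨fun x => G (κ (x.1, Function.update z i x.2)), ?_, ?_⟩
  · refine AnalyticAt.fun_comp (g := fun y => G (κ y))
      (f := fun x : ℂ × ℂ => (x.1, Function.update z i x.2)) (by rw [← hχ0]; exact hu) ?_
    refine analyticAt_fst.prod ?_
    rw [analyticAt_pi_iff]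
    intro k
    by_cases hk : k = i
    · subst hk
      simpa only [Function.update_self] using analyticAt_snd
    · simp only [Function.update_of_ne hk]
      exact analyticAt_const
  · filter_upwards [(analyticAt_straighten hF.1.1 i).continuousAt.eventually hindep, hκl]
      with q h1 h2
    rw [h2] at h1
    rw [h1]
    congr 3
    ext k
    simp only [straighten]
    by_cases hk : k = i
    · subst hk; simp [Function.update_of_ne hij]
    · have hk : k = j := by omega
      subst hk; simp [Function.update_of_ne hij.symm]

theorem tendsto_leafCoord (hF : IsNormalizedAt H η F z) :
    Tendsto (fun q : ℂ × (Fin 2 → ℂ) => (q.1, F q)) (𝓝 (0, z)) (𝓝 (0, eval z H)) := by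
  have := (continuousAt_fst.prodMk hF.1.1.continuousAt :
    ContinuousAt (fun q : ℂ × (Fin 2 → ℂ) => (q.1, F q)) (0, z)).tendsto
  rwa [hF.apply_zero] at this

/-- A germ is determined by its composition with a normalized first integral. -/
theorem IsNormalizedAt.eventuallyEq_of_comp (hF : IsNormalizedAt H η F z)
    (hreg : ∃ i, eval z (pderiv i H) ≠ 0) {g g' : ℂ × ℂ → ℂ}
    (h : (fun q => g (q.1, F q)) =ᶠ[𝓝 (0, z)] fun q => g' (q.1, F q)) :
    g =ᶠ[𝓝 (0, eval z H)] g' := by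
  obtain ⟨i, hi⟩ := hreg
  have hFi : fderiv ℂ F (0, z) (0, Pi.single i 1) ≠ 0 := by
    rwa [fderiv_of_eq_eval hF.1.1 hF.2]
  obtain ⟨κ, hκ, hκ0, -, hκr⟩ := exists_analytic_inverse (analyticAt_straighten hF.1.1 i)
    (fderiv_straighten_injective hF.1.1 hFi)
  have hχ0 : straighten F i (0, z) = (0, Function.update z i (eval z H)) := by
    simp [straighten, hF.apply_zero]
  -- Followed by κ, this map is a local section of (ε, F), so (ε, F) covers a neighbourhood of (0,
  -- H(z)).
  have hs : Tendsto (fun x : ℂ × ℂ => (x.1, Function.update z i x.2)) (𝓝 (0, eval z H))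
      (𝓝 (straighten F i (0, z))) := by
    rw [hχ0]
    exact (continuous_fst.prodMk (continuous_const.update i continuous_snd)).tendsto _
  have hκt : Tendsto κ (𝓝 (straighten F i (0, z))) (𝓝 (0, z)) := by
    have := hκ.continuousAt.tendsto
    rwa [hκ0] at this
  filter_upwards [(hκt.comp hs).eventually h, hs.eventually hκr] with x h1 h2
  have h3 : (κ (x.1, Function.update z i x.2)).1 = x.1 := congrArg Prod.fst h2
  have h4 : F (κ (x.1, Function.update z i x.2)) = x.2 := by
    simpa [straighten] using congrFun (congrArg Prod.snd h2) i
  simp only [Function.comp_apply, h3, h4] at h1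
  exact h1

end Structure

/-! ### First integrals on the transversal and their continuation along paths -/

section Continuation

variable {H : MvPolynomial (Fin 2) ℂ} {η : Fin 2 → MvPolynomial (Fin 2) ℂ}
variable {F G : ℂ × (Fin 2 → ℂ) → ℂ} {t₀ : ℂ} {p₀ : Fiber H t₀} {Γ : ℂ → Fin 2 → ℂ}

theorem IsTransversal.analyticAt_comp (hΓ : IsTransversal H Γ p₀) (hF : AnalyticAt ℂ F (0, p₀)) :
    AnalyticAt ℂ (fun x : ℂ × ℂ => F (x.1, Γ x.2)) (0, t₀) :=
  AnalyticAt.fun_comp (g := F) (f := fun x : ℂ × ℂ => (x.1, Γ x.2)) (by rwa [hΓ.base])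
    (analyticAt_fst.prod (AnalyticAt.fun_comp (f := fun x : ℂ × ℂ => x.2) hΓ.analyticAt
      analyticAt_snd))

theorem IsTransversal.tendsto_zero (hΓ : IsTransversal H Γ p₀) :
    Tendsto (fun x : ℂ × ℂ => (x.1, Γ x.2)) (𝓝 (0, t₀)) (𝓝 (0, p₀)) := by
  rw [← hΓ.base]
  exact (continuousAt_fst.prodMk
    (hΓ.analyticAt.continuousAt.comp (f := fun x : ℂ × ℂ => x.2) continuousAt_snd)).tendsto

theorem IsTransversal.normalized_apply (hΓ : IsTransversal H Γ p₀)
    (hF : IsNormalizedAt H η F p₀) : ∀ᶠ t in 𝓝 t₀, F (0, Γ t) = t := by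
  have h : Tendsto Γ (𝓝 t₀) (𝓝 p₀) := by
    rw [← hΓ.base]; exact hΓ.analyticAt.continuousAt
  filter_upwards [h.eventually hF.2, hΓ.param] with t h1 h2
  rw [h1, h2]

/-- On the transversal, `ε` and a normalized first integral are analytic coordinates. -/
theorem IsTransversal.exists_inverse (hΓ : IsTransversal H Γ p₀) (hF : IsNormalizedAt H η F p₀) :
    ∃ ν : ℂ × ℂ → ℂ × ℂ, AnalyticAt ℂ ν (0, t₀) ∧ ν (0, t₀) = (0, t₀) ∧
      (∀ᶠ x in 𝓝 ((0 : ℂ), t₀), ν (x.1, F (x.1, Γ x.2)) = x) ∧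
      ∀ᶠ y in 𝓝 ((0 : ℂ), t₀), ((ν y).1, F ((ν y).1, Γ (ν y).2)) = y := by
  have hN := hΓ.analyticAt_comp hF.1.1
  have hlam : AnalyticAt ℂ (fun x : ℂ × ℂ => (x.1, F (x.1, Γ x.2))) (0, t₀) :=
    analyticAt_fst.prod hN
  have h0 : F (0, Γ t₀) = t₀ := (hΓ.normalized_apply hF).self_of_nhds
  have hinj : ∀ v, fderiv ℂ (fun x : ℂ × ℂ => (x.1, F (x.1, Γ x.2))) (0, t₀) v = 0 → v = 0 := by
    intro v hv
    have hd : HasFDerivAt (fun x : ℂ × ℂ => (x.1, F (x.1, Γ x.2)))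
        ((ContinuousLinearMap.fst ℂ ℂ ℂ).prod
          (fderiv ℂ (fun x : ℂ × ℂ => F (x.1, Γ x.2)) (0, t₀))) (0, t₀) :=
      hasFDerivAt_fst.prodMk hN.differentiableAt.hasFDerivAt
    rw [hd.fderiv] at hv
    have h1 : v.1 = 0 := congrArg Prod.fst hv
    have h2 : fderiv ℂ (fun x : ℂ × ℂ => F (x.1, Γ x.2)) (0, t₀) v = 0 := congrArg Prod.snd hv
    -- At ε = 0 the normalized integral restricted to Γ is t itself, so its derivative in t is 1.
    have h3 : HasDerivAt (fun t : ℂ => F (0, Γ t))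
        (fderiv ℂ (fun x : ℂ × ℂ => F (x.1, Γ x.2)) (0, t₀) (0, 1)) t₀ :=
      hN.differentiableAt.hasFDerivAt.comp_hasDerivAt t₀
        ((hasDerivAt_const t₀ (0 : ℂ)).prodMk (hasDerivAt_id t₀))
    have h4 := h3.unique ((hasDerivAt_id t₀).congr_of_eventuallyEq (hΓ.normalized_apply hF))
    have h5 : v = v.2 • ((0 : ℂ), (1 : ℂ)) := by
      ext
      · simpa using h1
      · simp
    rw [h5, map_smul, h4] at h2
    rw [h5, show v.2 = 0 by simpa using h2, zero_smul]
  obtain ⟨ν, h1, h2, h3, h4⟩ := exists_analytic_inverse hlam hinj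
  simp only [h0] at h1 h2 h4
  exact ⟨ν, h1, h2, h3, h4⟩

/-- A first integral near the base point is determined by its values on the transversal. -/
theorem IsTransversal.eventuallyEq (hΓ : IsTransversal H Γ p₀)
    (hreg : ∀ z : Fin 2 → ℂ, eval z H = t₀ → ∃ i, eval z (pderiv i H) ≠ 0)
    (hF : IsFirstIntegralAt H η F p₀) (hG : IsFirstIntegralAt H η G p₀)
    (h : ∀ᶠ x in 𝓝 ((0 : ℂ), t₀), F (x.1, Γ x.2) = G (x.1, Γ x.2)) :
    F =ᶠ[𝓝 (0, (p₀ : Fin 2 → ℂ))] G := by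
  obtain ⟨i, hi⟩ := hreg p₀ p₀.2
  obtain ⟨N, hN⟩ := exists_isNormalizedAt η hi
  obtain ⟨f, hf, hfF⟩ := hN.exists_comp ⟨i, hi⟩ hF
  obtain ⟨g, hg, hgG⟩ := hN.exists_comp ⟨i, hi⟩ hG
  have ht := tendsto_leafCoord hN
  rw [p₀.2] at hf hg ht
  obtain ⟨ν, h1, h2, -, h4⟩ := hΓ.exists_inverse hN
  have hν : Tendsto ν (𝓝 (0, t₀)) (𝓝 (0, t₀)) := by
    have := h1.continuousAt.tendsto
    rwa [h2] at this
  have hfg : f =ᶠ[𝓝 (0, t₀)] g := by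
    filter_upwards [h4, hν.eventually h, hν.eventually (hΓ.tendsto_zero.eventually hfF),
      hν.eventually (hΓ.tendsto_zero.eventually hgG)] with y h5 h6 h7 h8
    rw [h7, h8, h5] at h6
    exact h6
  filter_upwards [hfF, hgG, ht.eventually hfg] with q h5 h6 h7
  rw [h5, h6, h7]

/-- There is a first integral with prescribed values on the transversal `t`. -/
theorem IsTransversal.exists_firstIntegral (hΓ : IsTransversal H Γ p₀)
    (hreg : ∀ z : Fin 2 → ℂ, eval z H = t₀ → ∃ i, eval z (pderiv i H) ≠ 0)
    (η : Fin 2 → MvPolynomial (Fin 2) ℂ) :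
    ∃ F, IsFirstIntegralAt H η F p₀ ∧ ∀ᶠ x in 𝓝 ((0 : ℂ), t₀), F (x.1, Γ x.2) = x.2 := by
  obtain ⟨i, hi⟩ := hreg p₀ p₀.2
  obtain ⟨N, hN⟩ := exists_isNormalizedAt η hi
  obtain ⟨ν, h1, h2, h3, -⟩ := hΓ.exists_inverse hN
  refine ⟨fun q => (ν (q.1, N q)).2, hN.1.comp (g := fun x => (ν x).2) ?_, ?_⟩
  · rw [hN.apply_zero, p₀.2]
    exact analyticAt_snd.fun_comp h1
  · filter_upwards [h3] with x hx
    rw [hx]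

/-- First integrals that agree near some nearby points of the fibre agree. -/
theorem eventuallyEq_of_frequently {z : Fiber H t₀}
    (hreg : ∀ z : Fin 2 → ℂ, eval z H = t₀ → ∃ i, eval z (pderiv i H) ≠ 0)
    (hF : IsFirstIntegralAt H η F z) (hG : IsFirstIntegralAt H η G z)
    (h : ∃ᶠ w : Fiber H t₀ in 𝓝 z, F =ᶠ[𝓝 (0, (w : Fin 2 → ℂ))] G) :
    F =ᶠ[𝓝 (0, (z : Fin 2 → ℂ))] G := by
  obtain ⟨i, hi⟩ := hreg z z.2
  obtain ⟨N, hN⟩ := exists_isNormalizedAt η hi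
  obtain ⟨f, hf, hfF⟩ := hN.exists_comp ⟨i, hi⟩ hF
  obtain ⟨g, hg, hgG⟩ := hN.exists_comp ⟨i, hi⟩ hG
  have hw : Tendsto (fun w : Fiber H t₀ => ((0 : ℂ), (w : Fin 2 → ℂ))) (𝓝 z) (𝓝 (0, z)) :=
    (continuous_const.prodMk continuous_subtype_val).tendsto z
  obtain ⟨w, h1, h2, h3, h4⟩ := (h.and_eventually
    ((hw.eventually hfF.eventually_nhds).and ((hw.eventually hgG.eventually_nhds).and
      (continuous_subtype_val.continuousAt.eventually hN.eventually)))).exists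
  have hfg : f =ᶠ[𝓝 (0, eval (w : Fin 2 → ℂ) H)] g := by
    refine h4.eventuallyEq_of_comp (hreg w w.2) ?_
    filter_upwards [h1, h2, h3] with q h5 h6 h7
    rw [← h6, ← h7, h5]
  -- All points of the fibre have the same coordinates (0, t₀) under (ε, N), so equality of the
  -- germs f and g seen from w is equality seen from z. This is why the set of agreement is closed.
  rw [w.2, ← z.2] at hfg
  filter_upwards [hfF, hgG, (tendsto_leafCoord hN).eventually hfg] with q h5 h6 h7
  rw [h5, h6, h7]

/-- A locally constant family of first integrals along a path. -/
def IsContinuation (η : Fin 2 → MvPolynomial (Fin 2) ℂ) {p q : Fiber H t₀} (γ : Path p q)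
    (F : unitInterval → ℂ × (Fin 2 → ℂ) → ℂ) : Prop :=
  (∀ s, IsFirstIntegralAt H η (F s) (γ s)) ∧
    ∀ s, ∀ᶠ s' in 𝓝 s, F s' =ᶠ[𝓝 ((0 : ℂ), (γ s' : Fin 2 → ℂ))] F s

/-- The continuation of first integrals along a path is unique. -/
theorem IsContinuation.unique {p q : Fiber H t₀} {γ : Path p q}
    (hreg : ∀ z : Fin 2 → ℂ, eval z H = t₀ → ∃ i, eval z (pderiv i H) ≠ 0)
    {F G : unitInterval → ℂ × (Fin 2 → ℂ) → ℂ} (hF : IsContinuation η γ F)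
    (hG : IsContinuation η γ G) {s₀ : unitInterval}
    (h : F s₀ =ᶠ[𝓝 ((0 : ℂ), (γ s₀ : Fin 2 → ℂ))] G s₀) (s : unitInterval) :
    F s =ᶠ[𝓝 ((0 : ℂ), (γ s : Fin 2 → ℂ))] G s := by
  let S : Set unitInterval := {s | F s =ᶠ[𝓝 ((0 : ℂ), (γ s : Fin 2 → ℂ))] G s}
  have hγ : ∀ s, Tendsto (fun s' => ((0 : ℂ), (γ s' : Fin 2 → ℂ))) (𝓝 s) (𝓝 (0, γ s)) := fun s =>
    (continuous_const.prodMk (continuous_subtype_val.comp γ.continuous)).tendsto s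
  have hopen : IsOpen S := by
    rw [isOpen_iff_mem_nhds]
    intro s hs
    filter_upwards [hF.2 s, hG.2 s, (hγ s).eventually (EventuallyEq.eventuallyEq_nhds hs)]
      with s' h1 h2 h3
    exact (h1.trans h3).trans h2.symm
  have hclosed : IsClosed S := by
    rw [isClosed_iff_frequently]
    intro s hs
    refine eventuallyEq_of_frequently hreg (hF.1 s) (hG.1 s) ?_
    refine (γ.continuous.tendsto s).frequently (hs.and_eventually
      ((hF.2 s).and (hG.2 s)) |>.mono ?_)
    rintro s' ⟨h1, h2, h3⟩
    exact (h2.symm.trans h1).trans h3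
  have huniv : S = Set.univ := IsClopen.eq_univ ⟨hclosed, hopen⟩ ⟨s₀, h⟩
  exact huniv.ge (Set.mem_univ s)

end Continuation

/-! ### The covering of the fibre by germs of first integrals -/

section Monodromy

variable {H : MvPolynomial (Fin 2) ℂ} {t₀ : ℂ}

/-- Germs at `(0, t₀)` of holomorphic functions of `(ε, t)`. -/
def ParamGerm (t₀ : ℂ) : Type :=
  {g : Germ (𝓝 ((0 : ℂ), t₀)) ℂ // ∃ f : ℂ × ℂ → ℂ, AnalyticAt ℂ f (0, t₀) ∧ (f : Germ _ ℂ) = g}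

/-- Germs are the fibre of the bundle below, and discreteness is what makes that bundle a covering.
-/
instance : TopologicalSpace (ParamGerm t₀) := ⊥

instance : DiscreteTopology (ParamGerm t₀) := ⟨rfl⟩

namespace ParamGerm

/-- The germ of a holomorphic function. -/
def mk (f : ℂ × ℂ → ℂ) (hf : AnalyticAt ℂ f (0, t₀)) : ParamGerm t₀ := ⟨f, f, hf, rfl⟩

/-- A representative of a germ. -/
def rep (g : ParamGerm t₀) : ℂ × ℂ → ℂ := g.2.choose

theorem analyticAt_rep (g : ParamGerm t₀) : AnalyticAt ℂ g.rep (0, t₀) := g.2.choose_spec.1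

theorem rep_mk (f : ℂ × ℂ → ℂ) (hf : AnalyticAt ℂ f (0, t₀)) :
    (mk f hf).rep =ᶠ[𝓝 (0, t₀)] f := Germ.coe_eq.mp (mk f hf).2.choose_spec.2

theorem ext_rep {g g' : ParamGerm t₀} (h : g.rep =ᶠ[𝓝 (0, t₀)] g'.rep) : g = g' := by
  apply Subtype.ext
  rw [← g.2.choose_spec.2, ← g'.2.choose_spec.2]
  exact Germ.coe_eq.mpr h

instance : Nonempty (ParamGerm t₀) := ⟨mk (fun _ => 0) analyticAt_const⟩

end ParamGerm

variable (η : Fin 2 → MvPolynomial (Fin 2) ℂ)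
  (hreg : ∀ z : Fin 2 → ℂ, eval z H = t₀ → ∃ i, eval z (pderiv i H) ≠ 0)

/-- A normalized first integral near a point of the fibre. -/
def localIntegral (z : Fiber H t₀) : ℂ × (Fin 2 → ℂ) → ℂ :=
  (exists_isNormalizedAt η (hreg z z.2).choose_spec).choose

theorem isNormalizedAt_localIntegral (z : Fiber H t₀) :
    IsNormalizedAt H η (localIntegral η hreg z) z :=
  (exists_isNormalizedAt η (hreg z z.2).choose_spec).choose_spec

/-- The germ at `z` of a function of `ε` and the normalized first integral near `i`. -/
def pullGerm (i z : Fiber H t₀) (g : ParamGerm t₀) : Germ (𝓝 ((0 : ℂ), (z : Fin 2 → ℂ))) ℂ :=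
  ((fun q => g.rep (q.1, localIntegral η hreg i q) : ℂ × (Fin 2 → ℂ) → ℂ) : Germ _ ℂ)

/-- The points near which a chosen first integral is normalized. -/
def normalizedSet (i : Fiber H t₀) : Set (Fiber H t₀) :=
  {z | IsNormalizedAt H η (localIntegral η hreg i) z}

theorem isOpen_normalizedSet (i : Fiber H t₀) : IsOpen (normalizedSet η hreg i) := by
  rw [isOpen_iff_mem_nhds]
  intro z hz
  exact continuous_subtype_val.continuousAt.eventually (IsNormalizedAt.eventually hz)

theorem pullGerm_injective {i z : Fiber H t₀} (hz : z ∈ normalizedSet η hreg i) :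
    Function.Injective (pullGerm η hreg i z) := by
  intro g g' h
  apply ParamGerm.ext_rep
  have := IsNormalizedAt.eventuallyEq_of_comp hz (hreg z z.2) (Germ.coe_eq.mp h)
  rwa [z.2] at this

theorem isFirstIntegralAt_rep {i z : Fiber H t₀} (hz : z ∈ normalizedSet η hreg i)
    (g : ParamGerm t₀) :
    IsFirstIntegralAt H η (fun q => g.rep (q.1, localIntegral η hreg i q)) z := by
  refine hz.1.comp ?_
  rw [hz.apply_zero, z.2]
  exact g.analyticAt_rep

/-- With `pullGerm_injective`, this identifies the germs at z of first integrals with the germs at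
(0, t₀). The fibre is the same for all z because H = t₀ on X. -/
theorem exists_pullGerm_eq {j z : Fiber H t₀} (hz : z ∈ normalizedSet η hreg j)
    {F : ℂ × (Fin 2 → ℂ) → ℂ} (hF : IsFirstIntegralAt H η F z) :
    ∃ g, pullGerm η hreg j z g = (F : Germ _ ℂ) := by
  obtain ⟨f, hf, hfF⟩ := hz.exists_comp (hreg z z.2) hF
  have ht := tendsto_leafCoord hz
  rw [z.2] at hf ht
  refine ⟨.mk f hf, Germ.coe_eq.mpr ?_⟩
  filter_upwards [ht.eventually (ParamGerm.rep_mk f hf), hfF] with q h1 h2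
  rw [h1, h2]

/-- The change of coordinates between two normalized first integrals. -/
def germChange (i j z : Fiber H t₀) (g : ParamGerm t₀) : ParamGerm t₀ :=
  Function.invFun (pullGerm η hreg j z) (pullGerm η hreg i z g)

theorem pullGerm_germChange {i j z : Fiber H t₀} (hi : z ∈ normalizedSet η hreg i)
    (hj : z ∈ normalizedSet η hreg j) (g : ParamGerm t₀) :
    pullGerm η hreg j z (germChange η hreg i j z g) = pullGerm η hreg i z g :=
  Function.invFun_eq (exists_pullGerm_eq η hreg hj (isFirstIntegralAt_rep η hreg hi g))

theorem germChange_eq_iff {i j z : Fiber H t₀} (hi : z ∈ normalizedSet η hreg i)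
    (hj : z ∈ normalizedSet η hreg j) (g g' : ParamGerm t₀) :
    germChange η hreg i j z g = g' ↔ pullGerm η hreg j z g' = pullGerm η hreg i z g := by
  rw [← pullGerm_germChange η hreg hi hj g, (pullGerm_injective η hreg hj).eq_iff, eq_comm]

/-- The covering of the fibre by the germs of first integrals of the deformed foliations. -/
def integralBundle : FiberBundleCore (Fiber H t₀) (Fiber H t₀) (ParamGerm t₀) where
  baseSet := normalizedSet η hreg
  isOpen_baseSet := isOpen_normalizedSet η hreg
  indexAt := id
  mem_baseSet_at := isNormalizedAt_localIntegral η hreg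
  coordChange := germChange η hreg
  coordChange_self i z hz g := (germChange_eq_iff η hreg hz hz g g).mpr rfl
  continuousOn_coordChange i j := by
    rintro ⟨z, g⟩ ⟨⟨hi, hj⟩, -⟩
    -- As the germs are discrete, continuity means that the change of coordinates is locally
    -- constant in z. It is: an equality of germs at z is an equality of functions near z, hence of
    -- germs at the points nearby.
    apply ContinuousAt.continuousWithinAt
    rw [ContinuousAt, nhds_prod_eq, nhds_discrete (ParamGerm t₀), tendsto_pure, prod_pure,
      eventually_map]
    have hw : Tendsto (fun w : Fiber H t₀ => ((0 : ℂ), (w : Fin 2 → ℂ))) (𝓝 z) (𝓝 (0, z)) :=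
      (continuous_const.prodMk continuous_subtype_val).tendsto z
    have h := Germ.coe_eq.mp (pullGerm_germChange η hreg hi hj g)
    filter_upwards [(isOpen_normalizedSet η hreg i).mem_nhds hi,
      (isOpen_normalizedSet η hreg j).mem_nhds hj, hw.eventually h.eventually_nhds]
      with w h1 h2 h3
    exact (germChange_eq_iff η hreg h1 h2 _ _).mpr (Germ.coe_eq.mpr h3)
  coordChange_comp i j k z hz g := by
    rw [germChange_eq_iff η hreg hz.1.2 hz.2, pullGerm_germChange η hreg hz.1.1 hz.2,
      pullGerm_germChange η hreg hz.1.1 hz.1.2]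

/-- The first integral represented by a point of the covering. -/
def bundleIntegral (e : (integralBundle η hreg).TotalSpace) : ℂ × (Fin 2 → ℂ) → ℂ :=
  fun q => ParamGerm.rep (show ParamGerm t₀ from e.2) (q.1, localIntegral η hreg e.1 q)

theorem isFirstIntegralAt_bundleIntegral (e : (integralBundle η hreg).TotalSpace) :
    IsFirstIntegralAt H η (bundleIntegral η hreg e) e.1 :=
  isFirstIntegralAt_rep η hreg (isNormalizedAt_localIntegral η hreg e.1) e.2

/-- In the trivialization around e, nearby points of the total space have the same germ as discrete
coordinate, so they are germs of one function. Lifted paths are therefore continuations. -/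
theorem eventually_bundleIntegral_eq (e : (integralBundle η hreg).TotalSpace) :
    ∀ᶠ e' in 𝓝 e, bundleIntegral η hreg e' =ᶠ[𝓝 ((0 : ℂ), (e'.1 : Fin 2 → ℂ))]
      bundleIntegral η hreg e := by
  let Z := integralBundle η hreg
  have hsrc : e ∈ (Z.localTrivAt e.1).source :=
    (Z.mem_localTrivAt_source e e.1).mpr (Z.mem_localTrivAt_baseSet e.1)
  have hc : ContinuousAt (fun e' => (Z.localTrivAt e.1 e').2) e :=
    continuousAt_snd.comp ((Z.localTrivAt e.1).continuousOn_toFun.continuousAt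
      ((Z.localTrivAt e.1).open_source.mem_nhds hsrc))
  have h1 : ∀ᶠ e' in 𝓝 e, (Z.localTrivAt e.1 e').2 = (Z.localTrivAt e.1 e).2 :=
    hc.eventually (eventually_mem_set.mpr (by rw [nhds_discrete]; exact rfl) :
      ∀ᶠ g in 𝓝 (Z.localTrivAt e.1 e).2, g = (Z.localTrivAt e.1 e).2)
  filter_upwards [h1, (Z.localTrivAt e.1).open_source.mem_nhds hsrc] with e' h2 h3
  have h4 : e'.1 ∈ normalizedSet η hreg e.1 := (Z.mem_localTrivAt_source e' e.1).mp h3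
  rw [Z.localTrivAt_apply] at h2
  have h5 := (germChange_eq_iff η hreg (isNormalizedAt_localIntegral η hreg e'.1) h4 e'.2 e.2).mp h2
  exact (Germ.coe_eq.mp h5).symm

theorem isCoveringMap_integralBundle :
    IsCoveringMap (Bundle.TotalSpace.proj : (integralBundle η hreg).TotalSpace → Fiber H t₀) :=
  FiberBundle.isCoveringMap

/-- First integrals can be continued along paths in the fibre, and the result depends only on the
homotopy class of the path. -/
theorem exists_continuation_of_homotopic
    (hreg : ∀ z : Fin 2 → ℂ, eval z H = t₀ → ∃ i, eval z (pderiv i H) ≠ 0) {p q : Fiber H t₀} {γ γ' : Path p q}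
    (h : γ.Homotopic γ') {F₀ : ℂ × (Fin 2 → ℂ) → ℂ} (hF₀ : IsFirstIntegralAt H η F₀ p) :
    ∃ F F' : unitInterval → ℂ × (Fin 2 → ℂ) → ℂ,
      IsContinuation η γ F ∧ IsContinuation η γ' F' ∧
      F 0 =ᶠ[𝓝 ((0 : ℂ), (p : Fin 2 → ℂ))] F₀ ∧ F' 0 =ᶠ[𝓝 ((0 : ℂ), (p : Fin 2 → ℂ))] F₀ ∧
      F 1 = F' 1 := by
  obtain ⟨g, hg⟩ := exists_pullGerm_eq η hreg (isNormalizedAt_localIntegral η hreg p) hF₀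
  have cov := isCoveringMap_integralBundle η hreg
  let e₀ : (integralBundle η hreg).TotalSpace := ⟨p, g⟩
  have he₀ : bundleIntegral η hreg e₀ =ᶠ[𝓝 ((0 : ℂ), (p : Fin 2 → ℂ))] F₀ := Germ.coe_eq.mp hg
  have hcont : ∀ γ : Path p q, IsContinuation η γ fun s =>
      bundleIntegral η hreg (cov.liftPath γ e₀ γ.source s) := by
    intro γ
    have hproj : ∀ s, (cov.liftPath γ e₀ γ.source s).1 = γ s := fun s =>
      congrFun (cov.liftPath_lifts γ e₀ γ.source) s
    refine ⟨fun s => ?_, fun s => ?_⟩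
    · rw [← hproj s]
      exact isFirstIntegralAt_bundleIntegral η hreg _
    · filter_upwards [((cov.liftPath γ e₀ γ.source).continuous.tendsto s).eventually
        (eventually_bundleIntegral_eq η hreg _)] with s' hs'
      rwa [hproj s'] at hs'
  refine ⟨_, _, hcont γ, hcont γ', ?_, ?_, ?_⟩
  · rw [cov.liftPath_zero]; exact he₀
  · rw [cov.liftPath_zero]; exact he₀
  · exact congrArg (bundleIntegral η hreg)
      (cov.liftPath_apply_one_eq_of_homotopicRel h e₀ γ.source γ'.source)

end Monodromy

/-! ### Existence, uniqueness and composition of holonomy maps -/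

section HolonomyGroup

variable {H : MvPolynomial (Fin 2) ℂ} {η : Fin 2 → MvPolynomial (Fin 2) ℂ}
variable {t₀ : ℂ} {p₀ : Fiber H t₀} {Γ : ℂ → Fin 2 → ℂ}

theorem IsContinuation.reparam {p q p' q' : Fiber H t₀} {γ : Path p q} {γ' : Path p' q'}
    {F : unitInterval → ℂ × (Fin 2 → ℂ) → ℂ} (hF : IsContinuation η γ F)
    {φ : unitInterval → unitInterval} (hφ : Continuous φ) (h : ∀ s, γ (φ s) = γ' s) :
    IsContinuation η γ' fun s => F (φ s) := by
  refine ⟨fun s => ?_, fun s => ?_⟩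
  · rw [← h s]
    exact hF.1 _
  · filter_upwards [(hφ.tendsto s).eventually (hF.2 (φ s))] with s' hs'
    rwa [h s'] at hs'

/-- The restriction to `ε = 0` of a first integral is a first integral of `dH = 0`. -/
theorem IsFirstIntegralAt.restrict_zero {F : ℂ × (Fin 2 → ℂ) → ℂ} {z : Fin 2 → ℂ}
    (hF : IsFirstIntegralAt H η F z) : IsFirstIntegralAt H 0 (fun q => F (0, q.2)) z := by
  refine ⟨AnalyticAt.fun_comp (g := F) (f := fun q : ℂ × (Fin 2 → ℂ) => ((0 : ℂ), q.2)) hF.1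
    (analyticAt_const.prod analyticAt_snd), ?_⟩
  have ht : Tendsto (fun q : ℂ × (Fin 2 → ℂ) => ((0 : ℂ), q.2)) (𝓝 (0, z)) (𝓝 (0, z)) :=
    (continuous_const.prodMk continuous_snd).tendsto ((0 : ℂ), z)
  filter_upwards [ht.eventually hF.2] with q hq
  simpa [spaceDeriv, deformedForm] using hq

theorem isFirstIntegralAt_eval (z : Fin 2 → ℂ) :
    IsFirstIntegralAt H 0 (fun q => eval q.2 H) z := by
  refine ⟨AnalyticAt.fun_comp (g := fun z => eval z H) (analyticAt_eval H z) analyticAt_snd, ?_⟩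
  refine Eventually.of_forall fun q => ?_
  have e : ∀ k, spaceDeriv (fun q => eval q.2 H) k q = eval q.2 (pderiv k H) := by
    intro k
    unfold spaceDeriv
    simp only [(hasFDerivAt_eval H q.2).fderiv]
    fin_cases k <;> simp [coordL]
  rw [e, e]
  simp [deformedForm, mul_comm]

/-- If a continuation equals `H` at `ε = 0` somewhere, it does so everywhere. -/
theorem IsContinuation.eq_eval {p q : Fiber H t₀} {γ : Path p q}
    (hreg : ∀ z : Fin 2 → ℂ, eval z H = t₀ → ∃ i, eval z (pderiv i H) ≠ 0)
    {F : unitInterval → ℂ × (Fin 2 → ℂ) → ℂ} (hF : IsContinuation η γ F) {s₀ : unitInterval}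
    (h : (fun q => F s₀ (0, q.2)) =ᶠ[𝓝 ((0 : ℂ), (γ s₀ : Fin 2 → ℂ))] fun q => eval q.2 H)
    (s : unitInterval) :
    ∀ᶠ w in 𝓝 (γ s : Fin 2 → ℂ), F s (0, w) = eval w H := by
  -- The restrictions to ε = 0 and the constant family H are both continuations for the undeformed
  -- foliation, that is for η = 0, so uniqueness compares them.
  have h0 : IsContinuation (0 : Fin 2 → MvPolynomial (Fin 2) ℂ) γ fun s q => F s (0, q.2) := by
    refine ⟨fun s => (hF.1 s).restrict_zero, fun s => ?_⟩
    filter_upwards [hF.2 s] with s' hs'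
    have ht : Tendsto (fun q : ℂ × (Fin 2 → ℂ) => ((0 : ℂ), q.2))
        (𝓝 (0, (γ s' : Fin 2 → ℂ))) (𝓝 (0, (γ s' : Fin 2 → ℂ))) :=
      (continuous_const.prodMk continuous_snd).tendsto ((0 : ℂ), (γ s' : Fin 2 → ℂ))
    exact ht.eventually hs'
  have h1 : IsContinuation (0 : Fin 2 → MvPolynomial (Fin 2) ℂ) γ fun _ q => eval q.2 H :=
    ⟨fun s => isFirstIntegralAt_eval _, fun s => Eventually.of_forall fun s' => EventuallyEq.rfl⟩
  have h2 := h0.unique hreg h1 h s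
  exact ((Continuous.prodMk_right (0 : ℂ)).tendsto (γ s : Fin 2 → ℂ)).eventually h2

/-- At ε = 0 both sides are first integrals of dH = 0, and both equal t on Γ. -/
theorem IsTransversal.eq_eval_of_param {F : ℂ × (Fin 2 → ℂ) → ℂ} (hΓ : IsTransversal H Γ p₀)
    (hreg : ∀ z : Fin 2 → ℂ, eval z H = t₀ → ∃ i, eval z (pderiv i H) ≠ 0)
    (hF : IsFirstIntegralAt H η F p₀)
    (h : ∀ᶠ x in 𝓝 ((0 : ℂ), t₀), F (x.1, Γ x.2) = x.2) :
    (fun q => F (0, q.2)) =ᶠ[𝓝 ((0 : ℂ), (p₀ : Fin 2 → ℂ))] fun q => eval q.2 H := by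
  refine hΓ.eventuallyEq hreg hF.restrict_zero (isFirstIntegralAt_eval _) ?_
  have h1 : ∀ᶠ t in 𝓝 t₀, F (0, Γ t) = t :=
    ((Continuous.prodMk_right (0 : ℂ)).tendsto t₀).eventually h
  filter_upwards [(continuous_snd.tendsto ((0 : ℂ), t₀)).eventually (h1.and hΓ.param)]
    with x hx
  rw [hx.1, hx.2]

theorem IsHolonomyAlong.congr {γ : Path p₀ p₀} {P P' : ℂ × ℂ → ℂ}
    (h : IsHolonomyAlong H η Γ γ P) (hP : P =ᶠ[𝓝 (0, t₀)] P') : IsHolonomyAlong H η Γ γ P' := by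
  obtain ⟨h1, F, h2, h3, h4, h5⟩ := h
  refine ⟨h1.congr hP, F, h2, h3, h4, ?_⟩
  filter_upwards [h5, hP] with x hx hx'
  rw [hx, hx']

/-- The normalization on Γ determines the germ at s = 1, and uniqueness of continuation carries it
to s = 0, where the holonomy is read. -/
theorem IsHolonomyAlong.eventuallyEq_of_continuation {γ : Path p₀ p₀} {P : ℂ × ℂ → ℂ}
    (hreg : ∀ z : Fin 2 → ℂ, eval z H = t₀ → ∃ i, eval z (pderiv i H) ≠ 0)
    (hΓ : IsTransversal H Γ p₀) (h : IsHolonomyAlong H η Γ γ P)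
    {F : unitInterval → ℂ × (Fin 2 → ℂ) → ℂ} (hF : IsContinuation η γ F)
    (h1 : ∀ᶠ x in 𝓝 ((0 : ℂ), t₀), F 1 (x.1, Γ x.2) = x.2) :
    (fun x => F 0 (x.1, Γ x.2)) =ᶠ[𝓝 (0, t₀)] P := by
  obtain ⟨-, G, h2, h3, h4, h5⟩ := h
  have e1 : F 1 =ᶠ[𝓝 ((0 : ℂ), (γ 1 : Fin 2 → ℂ))] G 1 := by
    have hF1 := hF.1 1
    have hG1 := h2 1
    rw [γ.target] at hF1 hG1 ⊢
    refine hΓ.eventuallyEq hreg hF1 hG1 ?_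
    filter_upwards [h1, h4] with x h6 h7
    rw [h6, h7]
  have e0 := hF.unique hreg ⟨h2, h3⟩ e1 0
  rw [γ.source] at e0
  filter_upwards [hΓ.tendsto_zero.eventually e0, h5] with x h6 h7
  rw [h6, h7]

/-- Homotopic loops have holonomies, and these are equal. -/
theorem exists_isHolonomyAlong_of_homotopic (η : Fin 2 → MvPolynomial (Fin 2) ℂ)
    (hreg : ∀ z : Fin 2 → ℂ, eval z H = t₀ → ∃ i, eval z (pderiv i H) ≠ 0)
    (hΓ : IsTransversal H Γ p₀) {γ γ' : Path p₀ p₀} (h : γ.Homotopic γ') :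
    ∃ P, IsHolonomyAlong H η Γ γ P ∧ IsHolonomyAlong H η Γ γ' P := by
  obtain ⟨F₁, hF₁, hF₁Γ⟩ := hΓ.exists_firstIntegral hreg η
  -- The integral is prescribed at the end of the loop, so it is continued along the reversed loop
  -- and time is reversed afterwards.
  obtain ⟨F, F', hF, hF', h0, h0', h1⟩ :=
    exists_continuation_of_homotopic η hreg h.symm₂ hF₁
  have key : ∀ (γ : Path p₀ p₀) (F : unitInterval → ℂ × (Fin 2 → ℂ) → ℂ),
      IsContinuation η γ.symm F → F 0 =ᶠ[𝓝 ((0 : ℂ), (p₀ : Fin 2 → ℂ))] F₁ →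
      IsHolonomyAlong H η Γ γ fun x => F 1 (x.1, Γ x.2) := by
    intro γ F hF h0
    have hσ : IsContinuation η γ fun s => F (unitInterval.symm s) :=
      hF.reparam unitInterval.continuous_symm fun s => by simp
    refine ⟨?_, _, hσ.1, hσ.2, ?_, ?_⟩
    · refine hΓ.analyticAt_comp ?_
      have := (hF.1 1).1
      rwa [γ.symm.target] at this
    · filter_upwards [hΓ.tendsto_zero.eventually h0, hF₁Γ] with x h2 h3
      simp only [unitInterval.symm_one]
      rw [h2, h3]
    · simp
  refine ⟨fun x => F 1 (x.1, Γ x.2), key γ F hF h0, ?_⟩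
  rw [h1]
  exact key γ' F' hF' h0'

theorem exists_loopClass_eq (δ : PiOne (Fiber H t₀) p₀) : ∃ γ : Path p₀ p₀, loopClass γ = δ := by
  induction δ using MulOpposite.rec' with | _ δ => ?_
  obtain ⟨γ, hγ⟩ := Path.Homotopic.Quotient.mk_surjective (FundamentalGroup.toPath δ)
  refine ⟨γ, ?_⟩
  unfold loopClass
  rw [hγ]

theorem homotopic_of_loopClass_eq {γ γ' : Path p₀ p₀} (h : loopClass γ = loopClass γ') :
    γ.Homotopic γ' :=
  Path.Homotopic.Quotient.eq.mp (MulOpposite.op_injective h)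

/-- The holonomy along a loop exists, is unique as a germ, and depends only on the homotopy class
of the loop. -/
theorem isHolonomyAlong_iff
    (hreg : ∀ z : Fin 2 → ℂ, eval z H = t₀ → ∃ i, eval z (pderiv i H) ≠ 0)
    (hΓ : IsTransversal H Γ p₀) (γ : Path p₀ p₀) (P : ℂ × ℂ → ℂ) :
    IsHolonomyAlong H η Γ γ P ↔ P =ᶠ[𝓝 ((0 : ℂ), t₀)] holonomy H η Γ (loopClass γ) := by
  have uniq : ∀ {γ : Path p₀ p₀} {P Q : ℂ × ℂ → ℂ}, IsHolonomyAlong H η Γ γ P →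
      IsHolonomyAlong H η Γ γ Q → P =ᶠ[𝓝 ((0 : ℂ), t₀)] Q := by
    intro γ P Q hP hQ
    obtain ⟨-, F, h2, h3, h4, h5⟩ := hP
    exact (EventuallyEq.symm h5).trans (hQ.eventuallyEq_of_continuation hreg hΓ ⟨h2, h3⟩ h4)
  obtain ⟨P₀, hP₀, -⟩ := exists_isHolonomyAlong_of_homotopic η hreg hΓ (Path.Homotopic.refl γ)
  have hex : ∃ P : ℂ × ℂ → ℂ, ∃ γ' : Path p₀ p₀, loopClass γ' = loopClass γ ∧
      IsHolonomyAlong H η Γ γ' P := ⟨P₀, γ, rfl, hP₀⟩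
  have hhol : IsHolonomyAlong H η Γ γ (holonomy H η Γ (loopClass γ)) := by
    unfold holonomy
    rw [dif_pos hex]
    -- The chosen germ is the holonomy of some loop of the class; homotopy invariance transfers it
    -- to γ.
    obtain ⟨γ', hγ', hP'⟩ := hex.choose_spec
    obtain ⟨Q, hQ, hQ'⟩ :=
      exists_isHolonomyAlong_of_homotopic η hreg hΓ (homotopic_of_loopClass_eq hγ')
    exact hQ'.congr (uniq hQ hP')
  exact ⟨fun h => uniq h hhol, fun h => hhol.congr h.symm⟩

/-- The holonomy is the identity at `ε = 0`. -/
theorem holonomy_zero (hreg : ∀ z : Fin 2 → ℂ, eval z H = t₀ → ∃ i, eval z (pderiv i H) ≠ 0)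
    (hΓ : IsTransversal H Γ p₀) (δ : PiOne (Fiber H t₀) p₀) :
    ∀ᶠ t in 𝓝 t₀, holonomy H η Γ δ (0, t) = t := by
  obtain ⟨γ, rfl⟩ := exists_loopClass_eq δ
  obtain ⟨-, F, h2, h3, h4, h5⟩ := (isHolonomyAlong_iff (η := η) hreg hΓ γ _).mpr EventuallyEq.rfl
  have hF1 := h2 1
  rw [γ.target] at hF1
  have h6 := hΓ.eq_eval_of_param hreg hF1 h4
  have h7 := IsContinuation.eq_eval hreg (γ := γ) ⟨h2, h3⟩ (s₀ := 1) (by rwa [γ.target]) 0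
  rw [γ.source, ← hΓ.base] at h7
  filter_upwards [hΓ.analyticAt.continuousAt.eventually h7, hΓ.param,
    ((Continuous.prodMk_right (0 : ℂ)).tendsto t₀).eventually h5] with t h8 h9 h10
  rw [← h10, h8, h9]

/-- The holonomy along `αβ` is the holonomy along `α` followed by the holonomy along `β`. -/
theorem holonomy_mul (hreg : ∀ z : Fin 2 → ℂ, eval z H = t₀ → ∃ i, eval z (pderiv i H) ≠ 0)
    (hΓ : IsTransversal H Γ p₀) (δ δ' : PiOne (Fiber H t₀) p₀) :
    holonomy H η Γ (δ * δ') =ᶠ[𝓝 ((0 : ℂ), t₀)]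
      fun x => holonomy H η Γ δ' (x.1, holonomy H η Γ δ x) := by
  obtain ⟨α, rfl⟩ := exists_loopClass_eq δ
  obtain ⟨β, rfl⟩ := exists_loopClass_eq δ'
  rw [loopClass_mul]
  set P := holonomy H η Γ (loopClass α)
  set Q := holonomy H η Γ (loopClass β)
  have hP : IsHolonomyAlong H η Γ α P := (isHolonomyAlong_iff hreg hΓ α _).mpr EventuallyEq.rfl
  have hQ : IsHolonomyAlong H η Γ β Q := (isHolonomyAlong_iff hreg hΓ β _).mpr EventuallyEq.rfl
  obtain ⟨-, F, h2, h3, h4, h5⟩ :=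
    (isHolonomyAlong_iff (η := η) hreg hΓ (α.trans β) _).mpr EventuallyEq.rfl
  have hF : IsContinuation η (α.trans β) F := ⟨h2, h3⟩
  let l : unitInterval → unitInterval := fun s =>
    ⟨s / 2, by have := s.2.1; have := s.2.2; constructor <;> linarith⟩
  let r : unitInterval → unitInterval := fun s =>
    ⟨(s + 1) / 2, by have := s.2.1; have := s.2.2; constructor <;> linarith⟩
  have hl : Continuous l := by
    apply Continuous.subtype_mk; fun_prop
  have hr : Continuous r := by
    apply Continuous.subtype_mk; fun_prop
  have hlα : ∀ s, (α.trans β) (l s) = α s := by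
    intro s
    have : (l s : ℝ) ≤ 1 / 2 := by
      have := s.2.2
      simp only [l]; linarith
    rw [Path.trans_apply, dif_pos this]
    congr 1
    ext
    simp only [l]; ring
  have hrβ : ∀ s, (α.trans β) (r s) = β s := by
    intro s
    rw [Path.trans_apply]
    split_ifs with h
    · have hs : s = 0 := by
        ext
        have := s.2.1
        simp only [r] at h
        simp only [Set.Icc.coe_zero]
        linarith
      subst hs
      rw [β.source]
      convert! α.target
      simp [r]
    · congr 1
      ext
      simp only [r]; ring
  have hFα : IsContinuation η α fun s => F (l s) := hF.reparam hl hlα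
  have hFβ : IsContinuation η β fun s => F (r s) := hF.reparam hr hrβ
  have hr1 : r 1 = 1 := by ext; simp [r]
  have hr0 : r 0 = l 1 := by ext; simp [r, l]
  have hl0 : l 0 = 0 := by ext; simp [l]
  -- On the second half F is a continuation along β, normalized at its end, so at the midpoint it
  -- restricts to Q on Γ.
  have hmid := hQ.eventuallyEq_of_continuation hreg hΓ hFβ (by simpa only [hr1] using h4)
  simp only [hr0] at hmid
  obtain ⟨-, A, a2, a3, a4, a5⟩ := hP
  have hA : IsContinuation η α A := ⟨a2, a3⟩
  have hA1 := a2 1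
  rw [α.target] at hA1
  have hAeval := hA.eq_eval hreg (s₀ := 1)
    (by rw [α.target]; exact hΓ.eq_eval_of_param hreg hA1 a4)
  -- This keeps (ε, A) near (0, t₀), where Q is holomorphic.
  have hA0 : ∀ s, A s (0, α s) = t₀ := fun s => by
    rw [(hAeval s).self_of_nhds, (α s).2]
  have hQan : AnalyticAt ℂ Q (0, t₀) := hQ.1
  -- Along α the family Q(ε, A) is a continuation that also restricts to Q on Γ at the end, so it is
  -- F; at the start A restricts to P.
  have hQA : IsContinuation η α fun s q => Q (q.1, A s q) := by
    refine ⟨fun s => (a2 s).comp (by rwa [hA0 s]), fun s => ?_⟩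
    filter_upwards [a3 s] with s' hs'
    filter_upwards [hs'] with q hq
    rw [hq]
  have e1 : F (l 1) =ᶠ[𝓝 ((0 : ℂ), (α 1 : Fin 2 → ℂ))] fun q => Q (q.1, A 1 q) := by
    have h6 := hFα.1 1
    have h7 := hQA.1 1
    simp only [α.target] at h6 h7 ⊢
    refine hΓ.eventuallyEq hreg h6 h7 ?_
    filter_upwards [hmid, a4] with x h8 h9
    simp only [h8, h9]
  have e0 := hFα.unique hreg hQA e1 0
  simp only [α.source, hl0] at e0
  filter_upwards [hΓ.tendsto_zero.eventually e0, h5, a5] with x h8 h9 h10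
  rw [← h9, h8]
  simp only [h10]

end HolonomyGroup

/-! ### Leading terms in ε, uniformly for t near a point -/

section Expansion

open Asymptotics

/-- The coefficient of `ε^k` in `P(ε, t)`. -/
def epsCoeff (k : ℕ) (P : ℂ × ℂ → ℂ) (t : ℂ) : ℂ :=
  (k.factorial : ℂ)⁻¹ * iteratedDeriv k (fun ε => P (ε, t)) 0

/-- The partial derivative in `ε`. -/
def epsDeriv (P : ℂ × ℂ → ℂ) (x : ℂ × ℂ) : ℂ := deriv (fun ε => P (ε, x.2)) x.1

theorem hasDerivAt_eps {P : ℂ × ℂ → ℂ} {ε t : ℂ} (hP : AnalyticAt ℂ P (ε, t)) :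
    HasDerivAt (fun ε => P (ε, t)) (epsDeriv P (ε, t)) ε := by
  have h3 : HasDerivAt (fun ε : ℂ => (ε, t)) ((1, 0) : ℂ × ℂ) ε :=
    (hasDerivAt_id ε).prodMk (hasDerivAt_const ε t)
  exact (hP.differentiableAt.hasFDerivAt.comp_hasDerivAt ε h3).differentiableAt.hasDerivAt

theorem analyticAt_epsDeriv {P : ℂ × ℂ → ℂ} {x : ℂ × ℂ} (hP : AnalyticAt ℂ P x) :
    AnalyticAt ℂ (epsDeriv P) x := by
  have h2 : AnalyticAt ℂ (fun x : ℂ × ℂ => fderiv ℂ P x (1, 0)) x :=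
    ((ContinuousLinearMap.apply ℂ ℂ ((1, 0) : ℂ × ℂ)).analyticAt _).comp hP.fderiv
  refine h2.congr ?_
  filter_upwards [hP.eventually_analyticAt] with x hx
  have h3 : HasDerivAt (fun ε : ℂ => (ε, x.2)) ((1, 0) : ℂ × ℂ) x.1 :=
    (hasDerivAt_id x.1).prodMk (hasDerivAt_const x.1 x.2)
  exact (hx.differentiableAt.hasFDerivAt.comp_hasDerivAt x.1 h3).deriv.symm

theorem iteratedDeriv_epsDeriv (P : ℂ × ℂ → ℂ) (j : ℕ) (t : ℂ) :
    iteratedDeriv j (fun ε => epsDeriv P (ε, t)) 0 =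
      iteratedDeriv (j + 1) (fun ε => P (ε, t)) 0 := by
  rw [iteratedDeriv_succ']
  rfl

theorem epsCoeff_epsDeriv (P : ℂ × ℂ → ℂ) (k : ℕ) (t : ℂ) :
    epsCoeff k (epsDeriv P) t = (k + 1) * epsCoeff (k + 1) P t := by
  unfold epsCoeff
  rw [iteratedDeriv_epsDeriv, Nat.factorial_succ]
  have : (k.factorial : ℂ) ≠ 0 := Nat.cast_ne_zero.mpr k.factorial_ne_zero
  have : (k + 1 : ℂ) ≠ 0 := Nat.cast_add_one_ne_zero k
  push_cast
  field_simp

theorem norm_le_of_deriv_bound {φ φ' : ℂ → ℂ} {ε : ℂ} {M : ℝ} (h0 : φ 0 = 0)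
    (h : ∀ x, ‖x‖ ≤ ‖ε‖ → HasDerivAt φ (φ' x) x) (hM : ∀ x, ‖x‖ ≤ ‖ε‖ → ‖φ' x‖ ≤ M) :
    ‖φ ε‖ ≤ M * ‖ε‖ := by
  have := (convex_closedBall (0 : ℂ) ‖ε‖).norm_image_sub_le_of_norm_hasDerivWithin_le
    (f := φ) (f' := φ') (C := M) (x := 0) (y := ε)
    (fun x hx => (h x (by simpa using hx)).hasDerivWithinAt) (fun x hx => hM x (by simpa using hx))
    (by simp) (by simp)
  simpa [h0] using this

/-- The leading term in `ε` of a holomorphic function of `(ε, t)`. -/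
theorem isLittleO_leading (k : ℕ) {g : ℂ × ℂ → ℂ} {t : ℂ} (hg : AnalyticAt ℂ g (0, t))
    (h : ∀ᶠ t' in 𝓝 t, ∀ j < k, iteratedDeriv j (fun ε => g (ε, t')) 0 = 0) :
    (fun x : ℂ × ℂ => g x - x.1 ^ k * epsCoeff k g t) =o[𝓝 (0, t)] fun x => x.1 ^ k := by
  induction k generalizing g with
  | zero =>
    have : (fun x => g x - g (0, t)) =o[𝓝 (0, t)] fun _ => (1 : ℂ) := by
      rw [isLittleO_one_iff]
      have h1 : ContinuousAt (fun x => g x - g (0, t)) (0, t) :=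
        hg.continuousAt.sub continuousAt_const
      simpa [ContinuousAt] using h1
    simpa [epsCoeff] using this
  | succ k ih =>
    -- The ε-derivative vanishes to order k. Its estimate, integrated from 0 to ε by the mean value
    -- inequality, gains one power of ε. The coefficient is taken at the fixed t while the point
    -- varies; continuity, in the case k = 0, absorbs the difference.
    have ih' := ih (analyticAt_epsDeriv hg) (by
      filter_upwards [h] with t' ht' j hj
      rw [iteratedDeriv_epsDeriv]
      exact ht' _ (by omega))
    rw [isLittleO_iff] at ih' ⊢
    intro C hC
    have h0 : ∀ᶠ x : ℂ × ℂ in 𝓝 (0, t), g (0, x.2) = 0 := by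
      filter_upwards [(continuous_snd.tendsto ((0 : ℂ), t)).eventually h] with x hx
      simpa using hx 0 (by omega)
    obtain ⟨r, hr, hball⟩ := Metric.eventually_nhds_iff_ball.mp
      ((ih' hC).and (hg.eventually_analyticAt.and h0))
    filter_upwards [Metric.ball_mem_nhds _ hr] with x hx
    have hmem : ∀ ε : ℂ, ‖ε‖ ≤ ‖x.1‖ → (ε, x.2) ∈ Metric.ball ((0 : ℂ), t) r := by
      intro ε hε
      rw [Metric.mem_ball, Prod.dist_eq, max_lt_iff] at *
      exact ⟨by simpa using hε.trans_lt (by simpa using hx.1), hx.2⟩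
    have key := norm_le_of_deriv_bound (ε := x.1) (M := C * ‖x.1‖ ^ k)
      (φ := fun ε => g (ε, x.2) - ε ^ (k + 1) * epsCoeff (k + 1) g t)
      (φ' := fun ε => epsDeriv g (ε, x.2) - ε ^ k * epsCoeff k (epsDeriv g) t)
      (by simpa using (hball x hx).2.2) (by
        intro ε hε
        have h1 := (hasDerivAt_eps (hball _ (hmem ε hε)).2.1).sub
          ((hasDerivAt_pow (k + 1) ε).mul_const (epsCoeff (k + 1) g t))
        refine h1.congr_deriv ?_
        rw [epsCoeff_epsDeriv]
        push_cast
        ring) (by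
        intro ε hε
        refine (hball _ (hmem ε hε)).1.trans ?_
        rw [norm_pow]
        gcongr)
    rw [norm_pow, pow_succ ‖x.1‖, ← mul_assoc]
    exact key

/-- The leading term in `ε` of the increments of a holomorphic function of `(ε, t)`. -/
theorem isLittleO_leading_sub (k : ℕ) {g : ℂ × ℂ → ℂ} {t : ℂ} (hg : AnalyticAt ℂ g (0, t))
    (h : ∀ᶠ t' in 𝓝 t, ∀ j < k, iteratedDeriv j (fun ε => g (ε, t')) 0 = 0) :
    (fun y : ℂ × ℂ × ℂ => g (y.1, y.2.1) - g (y.1, y.2.2) -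
      y.1 ^ k * deriv (epsCoeff k g) t * (y.2.1 - y.2.2)) =o[𝓝 (0, t, t)]
      fun y => y.1 ^ k * (y.2.1 - y.2.2) := by
  induction k generalizing g with
  | zero =>
    -- Strict differentiability is needed since both points of the increment move.
    have hs := hg.hasStrictFDerivAt.isLittleO
    have ht : Tendsto (fun y : ℂ × ℂ × ℂ => ((y.1, y.2.1), (y.1, y.2.2))) (𝓝 (0, t, t))
        (𝓝 ((0, t), (0, t))) :=
      Continuous.tendsto (f := fun y : ℂ × ℂ × ℂ => ((y.1, y.2.1), (y.1, y.2.2)))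
        (by fun_prop) (0, t, t)
    have hd : deriv (epsCoeff 0 g) t = fderiv ℂ g (0, t) (0, 1) := by
      have h1 : HasDerivAt (fun t : ℂ => g (0, t)) (fderiv ℂ g (0, t) (0, 1)) t :=
        hg.differentiableAt.hasFDerivAt.comp_hasDerivAt t
          ((hasDerivAt_const t (0 : ℂ)).prodMk (hasDerivAt_id t))
      rw [← h1.deriv]
      congr 1
      ext s
      simp [epsCoeff]
    have h2 := hs.comp_tendsto ht
    refine (h2.congr_left ?_).trans_isBigO ?_
    · intro y
      simp only [Function.comp_apply, pow_zero, one_mul, hd]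
      have h3 : ((y.1, y.2.1) - (y.1, y.2.2) : ℂ × ℂ) = (y.2.1 - y.2.2) • ((0 : ℂ), (1 : ℂ)) := by
        simp
      rw [h3, map_smul, smul_eq_mul]
      ring
    · refine IsBigO.of_bound 1 (Eventually.of_forall fun y => ?_)
      simp [Prod.norm_def]
  | succ k ih =>
    have ih' := ih (analyticAt_epsDeriv hg) (by
      filter_upwards [h] with t' ht' j hj
      rw [iteratedDeriv_epsDeriv]
      exact ht' _ (by omega))
    have hc : deriv (epsCoeff k (epsDeriv g)) t = (k + 1) * deriv (epsCoeff (k + 1) g) t := by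
      rw [funext (epsCoeff_epsDeriv g k), deriv_const_mul_field]
    rw [isLittleO_iff] at ih' ⊢
    intro C hC
    have hl : Tendsto (fun y : ℂ × ℂ × ℂ => (y.1, y.2.1)) (𝓝 (0, t, t)) (𝓝 (0, t)) :=
      Continuous.tendsto (f := fun y : ℂ × ℂ × ℂ => (y.1, y.2.1)) (by fun_prop) (0, t, t)
    have hr : Tendsto (fun y : ℂ × ℂ × ℂ => (y.1, y.2.2)) (𝓝 (0, t, t)) (𝓝 (0, t)) :=
      Continuous.tendsto (f := fun y : ℂ × ℂ × ℂ => (y.1, y.2.2)) (by fun_prop) (0, t, t)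
    have h0 : ∀ᶠ x : ℂ × ℂ in 𝓝 (0, t), g (0, x.2) = 0 := by
      filter_upwards [(continuous_snd.tendsto ((0 : ℂ), t)).eventually h] with x hx
      simpa using hx 0 (by omega)
    have h1 := hg.eventually_analyticAt.and h0
    obtain ⟨r, hr, hball⟩ := Metric.eventually_nhds_iff_ball.mp
      ((ih' hC).and ((hl.eventually h1).and (hr.eventually h1)))
    filter_upwards [Metric.ball_mem_nhds _ hr] with y hy
    have hmem : ∀ ε : ℂ, ‖ε‖ ≤ ‖y.1‖ → (ε, y.2) ∈ Metric.ball ((0 : ℂ), (t, t)) r := by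
      intro ε hε
      rw [Metric.mem_ball, Prod.dist_eq, max_lt_iff] at *
      exact ⟨by simpa using hε.trans_lt (by simpa using hy.1), hy.2⟩
    have key := norm_le_of_deriv_bound (ε := y.1) (M := C * (‖y.1‖ ^ k * ‖y.2.1 - y.2.2‖))
      (φ := fun ε => g (ε, y.2.1) - g (ε, y.2.2) -
        ε ^ (k + 1) * deriv (epsCoeff (k + 1) g) t * (y.2.1 - y.2.2))
      (φ' := fun ε => epsDeriv g (ε, y.2.1) - epsDeriv g (ε, y.2.2) -
        ε ^ k * deriv (epsCoeff k (epsDeriv g)) t * (y.2.1 - y.2.2))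
      (by simp [(hball y hy).2.1.2, (hball y hy).2.2.2]) (by
        intro ε hε
        have h1 := ((hasDerivAt_eps (hball _ (hmem ε hε)).2.1.1).sub
          (hasDerivAt_eps (hball _ (hmem ε hε)).2.2.1)).sub
          (((hasDerivAt_pow (k + 1) ε).mul_const (deriv (epsCoeff (k + 1) g) t)).mul_const
            (y.2.1 - y.2.2))
        refine h1.congr_deriv ?_
        rw [hc]
        push_cast
        ring) (by
        intro ε hε
        refine (hball _ (hmem ε hε)).1.trans ?_
        rw [norm_mul, norm_pow]
        gcongr)
    rw [norm_mul, norm_pow, pow_succ]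
    calc _ ≤ _ := key
      _ = _ := by ring

end Expansion

/-! ### Composition and commutators of families tangent to the identity -/

section Tangent

open Asymptotics

theorem eq_zero_of_pow_mul_isLittleO {N : ℕ} {c : ℂ}
    (h : (fun ε : ℂ => ε ^ N * c) =o[𝓝 0] fun ε : ℂ => ε ^ N) : c = 0 := by
  by_contra hc
  rw [isLittleO_iff] at h
  have hc' : 0 < ‖c‖ / 2 := by positivity
  obtain ⟨ε, h1, h2⟩ := (((h hc').filter_mono nhdsWithin_le_nhds).and
    (self_mem_nhdsWithin (s := {(0 : ℂ)}ᶜ))).exists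
  have h3 : 0 < ‖ε ^ N‖ := norm_pos_iff.mpr (pow_ne_zero _ h2)
  rw [norm_mul] at h1
  nlinarith

theorem pow_mul_const_isBigO (N : ℕ) (c : ℂ) :
    (fun ε : ℂ => ε ^ N * c) =O[𝓝 0] fun ε : ℂ => ε ^ N :=
  IsBigO.of_bound ‖c‖ (Eventually.of_forall fun ε => by rw [norm_mul, mul_comm])

theorem pow_isLittleO_pow_zero {j N : ℕ} (h : j < N) :
    (fun ε : ℂ => ε ^ N) =o[𝓝 0] fun ε : ℂ => ε ^ j :=
  isLittleO_pow_pow h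

/-- The Taylor coefficients are determined by an asymptotic expansion. -/
theorem iteratedDeriv_of_isLittleO {φ : ℂ → ℂ} (hφ : AnalyticAt ℂ φ 0) {N : ℕ} {w : ℂ}
    (h : (fun ε => φ ε - ε ^ N * w) =o[𝓝 0] fun ε : ℂ => ε ^ N) :
    (∀ j < N, iteratedDeriv j φ 0 = 0) ∧ (N.factorial : ℂ)⁻¹ * iteratedDeriv N φ 0 = w := by
  have hlead : ∀ j, (∀ i < j, iteratedDeriv i φ 0 = 0) →
      (fun ε => φ ε - ε ^ j * ((j.factorial : ℂ)⁻¹ * iteratedDeriv j φ 0)) =o[𝓝 0]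
        fun ε : ℂ => ε ^ j := by
    intro j hj
    have h1 := isLittleO_leading j (g := fun x : ℂ × ℂ => φ x.1) (t := 0)
      (hφ.fun_comp (f := fun x : ℂ × ℂ => x.1) analyticAt_fst)
      (Eventually.of_forall fun _ => hj)
    exact h1.comp_tendsto ((Continuous.prodMk_left (0 : ℂ)).tendsto (0 : ℂ))
  have hlow : ∀ j < N, iteratedDeriv j φ 0 = 0 := by
    intro j
    induction j using Nat.strong_induction_on with | _ j ih => ?_
    intro hj
    have h1 := hlead j fun i hi => ih i hi (hi.trans hj)
    have h2 : φ =o[𝓝 0] fun ε : ℂ => ε ^ j := by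
      have h3 := (h.trans (pow_isLittleO_pow_zero hj)).add
        ((pow_mul_const_isBigO N w).trans_isLittleO (pow_isLittleO_pow_zero hj))
      simpa using h3
    have h4 := eq_zero_of_pow_mul_isLittleO (N := j)
      (c := (j.factorial : ℂ)⁻¹ * iteratedDeriv j φ 0) ((h2.sub h1).congr_left fun ε => by ring)
    exact (mul_eq_zero.mp h4).resolve_left
      (inv_ne_zero (Nat.cast_ne_zero.mpr j.factorial_ne_zero))
  refine ⟨hlow, ?_⟩
  have h1 := hlead N hlow
  exact sub_eq_zero.mp (eq_zero_of_pow_mul_isLittleO (N := N)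
    (c := (N.factorial : ℂ)⁻¹ * iteratedDeriv N φ 0 - w) ((h.sub h1).congr_left fun ε => by ring))

/-- The family `P(ε, ·)` is the identity up to terms of order `ε^k`, near `t`. -/
structure IsTangentAt (k : ℕ) (P : ℂ × ℂ → ℂ) (t : ℂ) : Prop where
  analyticAt : AnalyticAt ℂ P (0, t)
  eventually : ∀ᶠ t' in 𝓝 t, P (0, t') = t' ∧
    ∀ j, j ≠ 0 → j < k → iteratedDeriv j (fun ε => P (ε, t')) 0 = 0

theorem iteratedDeriv_sub_const_of_ne_zero (f : ℂ → ℂ) (c : ℂ) {j : ℕ} (hj : j ≠ 0) :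
    iteratedDeriv j (fun ε => f ε - c) 0 = iteratedDeriv j f 0 := by
  obtain ⟨j, rfl⟩ := Nat.exists_eq_succ_of_ne_zero hj
  rw [Nat.succ_eq_add_one, iteratedDeriv_succ', iteratedDeriv_succ']
  congr 1
  ext ε
  exact deriv_sub_const c

variable {k l : ℕ} {P Q K S : ℂ × ℂ → ℂ} {t : ℂ}

theorem epsCoeff_sub_snd (hk : k ≠ 0) (P : ℂ × ℂ → ℂ) :
    epsCoeff k (fun x => P x - x.2) = epsCoeff k P := by
  ext t
  simp only [epsCoeff, iteratedDeriv_sub_const_of_ne_zero _ _ hk]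

theorem IsTangentAt.vanish (h : IsTangentAt k P t) :
    ∀ᶠ t' in 𝓝 t, ∀ j < k, iteratedDeriv j (fun ε => P (ε, t') - t') 0 = 0 := by
  filter_upwards [h.eventually] with t' ht' j hj
  rcases eq_or_ne j 0 with rfl | h0
  · simp [ht'.1]
  · rw [iteratedDeriv_sub_const_of_ne_zero _ _ h0]
    exact ht'.2 j h0 hj

/-- The starting point a(ε) may move with ε although the coefficient is taken at its limit t; this
is what allows expanding Q at P(ε, t). -/
theorem IsTangentAt.isLittleO (h : IsTangentAt k P t) (hk : k ≠ 0) {a : ℂ → ℂ}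
    (ha : Tendsto a (𝓝 0) (𝓝 t)) :
    (fun ε => P (ε, a ε) - a ε - ε ^ k * epsCoeff k P t) =o[𝓝 0] fun ε : ℂ => ε ^ k := by
  have h1 := isLittleO_leading k (g := fun x => P x - x.2) (h.analyticAt.sub analyticAt_snd)
    h.vanish
  rw [epsCoeff_sub_snd hk] at h1
  exact h1.comp_tendsto (k := fun ε => (ε, a ε)) (tendsto_id.prodMk_nhds ha)

theorem IsTangentAt.isLittleO_sub (h : IsTangentAt k P t) (hk : k ≠ 0) {a b : ℂ → ℂ}
    (ha : Tendsto a (𝓝 0) (𝓝 t)) (hb : Tendsto b (𝓝 0) (𝓝 t)) :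
    (fun ε => (P (ε, a ε) - a ε) - (P (ε, b ε) - b ε) -
      ε ^ k * deriv (epsCoeff k P) t * (a ε - b ε)) =o[𝓝 0] fun ε => ε ^ k * (a ε - b ε) := by
  have h1 := isLittleO_leading_sub k (g := fun x => P x - x.2) (h.analyticAt.sub analyticAt_snd)
    h.vanish
  rw [epsCoeff_sub_snd hk] at h1
  exact h1.comp_tendsto (k := fun ε => (ε, a ε, b ε))
    (tendsto_id.prodMk_nhds (ha.prodMk_nhds hb))

theorem IsTangentAt.tendsto (h : IsTangentAt k P t) :
    Tendsto (fun ε => P (ε, t)) (𝓝 0) (𝓝 t) := by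
  have h1 : ContinuousAt (fun ε => P (ε, t)) 0 :=
    h.analyticAt.continuousAt.comp (f := fun ε : ℂ => (ε, t))
      (Continuous.prodMk_left t).continuousAt
  have h2 := h1.tendsto
  rwa [h.eventually.self_of_nhds.1] at h2

theorem IsTangentAt.isBigO (h : IsTangentAt k P t) (hk : k ≠ 0) :
    (fun ε => P (ε, t) - t) =O[𝓝 0] fun ε : ℂ => ε ^ k := by
  have h1 := (h.isLittleO hk tendsto_const_nhds).isBigO.add
    (pow_mul_const_isBigO k (epsCoeff k P t))
  simpa using h1

/-- An asymptotic expansion determines the leading coefficient. -/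
theorem epsCoeff_of_isLittleO {N : ℕ} (hN : N ≠ 0) {w : ℂ} (hK : AnalyticAt ℂ K (0, t))
    (h : (fun ε => K (ε, t) - t - ε ^ N * w) =o[𝓝 0] fun ε : ℂ => ε ^ N) :
    (∀ j, j ≠ 0 → j < N → iteratedDeriv j (fun ε => K (ε, t)) 0 = 0) ∧ epsCoeff N K t = w := by
  have hφ : AnalyticAt ℂ (fun ε => K (ε, t) - t) 0 :=
    (hK.fun_comp (f := fun ε : ℂ => (ε, t)) (analyticAt_id.prod analyticAt_const)).sub
      analyticAt_const
  obtain ⟨h1, h2⟩ := iteratedDeriv_of_isLittleO hφ h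
  refine ⟨fun j h0 hj => ?_, ?_⟩
  · rw [← iteratedDeriv_sub_const_of_ne_zero _ t h0]
    exact h1 j hj
  · rw [← h2, epsCoeff, iteratedDeriv_sub_const_of_ne_zero _ t hN]

/-- The leading coefficient of a composition is the sum of the leading coefficients. -/
theorem IsTangentAt.epsCoeff_comp (hP : IsTangentAt k P t) (hQ : IsTangentAt k Q t) (hk : k ≠ 0)
    (hK : AnalyticAt ℂ K (0, t)) (h : ∀ᶠ ε in 𝓝 (0 : ℂ), K (ε, t) = Q (ε, P (ε, t))) :
    epsCoeff k K t = epsCoeff k P t + epsCoeff k Q t := by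
  refine (epsCoeff_of_isLittleO hk hK ?_).2
  refine ((hQ.isLittleO hk hP.tendsto).add (hP.isLittleO hk tendsto_const_nhds)).congr' ?_
    EventuallyEq.rfl
  filter_upwards [h] with ε hε
  rw [hε]
  ring

/-- Moving the starting point by ε^k f changes the displacement of Q by ε^l g' times that amount,
where f and g are the leading coefficients of P and Q. Antisymmetrizing gives the Wronskian. -/
theorem IsTangentAt.isLittleO_comp (hP : IsTangentAt k P t) (hQ : IsTangentAt l Q t) (hk : k ≠ 0)
    (hl : l ≠ 0) :
    (fun ε => Q (ε, P (ε, t)) - P (ε, t) - (Q (ε, t) - t) -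
      ε ^ (k + l) * (deriv (epsCoeff l Q) t * epsCoeff k P t)) =o[𝓝 0]
      fun ε : ℂ => ε ^ (k + l) := by
  have h1 : (fun ε : ℂ => ε ^ l * (P (ε, t) - t)) =O[𝓝 0] fun ε : ℂ => ε ^ (k + l) := by
    simp only [pow_add, mul_comm (_ ^ k)]
    exact (isBigO_refl _ _).mul (hP.isBigO hk)
  have h2 := (hQ.isLittleO_sub hl hP.tendsto tendsto_const_nhds).trans_isBigO h1
  have h3 : (fun ε : ℂ => ε ^ l * deriv (epsCoeff l Q) t *
      (P (ε, t) - t - ε ^ k * epsCoeff k P t)) =o[𝓝 0] fun ε : ℂ => ε ^ (k + l) := by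
    have e : (fun ε : ℂ => ε ^ (k + l)) = fun ε => ε ^ l * ε ^ k := by ext; ring
    rw [e]
    exact (pow_mul_const_isBigO l _).mul_isLittleO
      (hP.isLittleO hk tendsto_const_nhds)
  refine (h2.add h3).congr_left fun ε => ?_
  ring

/-- The leading term of a commutator of families tangent to the identity. -/
theorem IsTangentAt.commutator (hP : IsTangentAt k P t) (hQ : IsTangentAt l Q t) (hk : k ≠ 0)
    (hl : l ≠ 0) (hS : IsTangentAt 1 S t) (hK : IsTangentAt 1 K t)
    (hSPQ : ∀ᶠ ε in 𝓝 (0 : ℂ), S (ε, t) = P (ε, Q (ε, t)))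
    (h : ∀ᶠ ε in 𝓝 (0 : ℂ), Q (ε, P (ε, t)) = S (ε, K (ε, t))) :
    (∀ j, j ≠ 0 → j < k + l → iteratedDeriv j (fun ε => K (ε, t)) 0 = 0) ∧
      epsCoeff (k + l) K t =
        epsCoeff k P t * deriv (epsCoeff l Q) t - deriv (epsCoeff k P) t * epsCoeff l Q t := by
  refine epsCoeff_of_isLittleO (by omega) hK.analyticAt ?_
  set W := epsCoeff k P t * deriv (epsCoeff l Q) t - deriv (epsCoeff k P) t * epsCoeff l Q t
  -- In the difference of the two expansions the displacements of P and Q from t cancel.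
  have hD : (fun ε => Q (ε, P (ε, t)) - P (ε, Q (ε, t)) - ε ^ (k + l) * W) =o[𝓝 0]
      fun ε : ℂ => ε ^ (k + l) := by
    have h1 := hP.isLittleO_comp hQ hk hl
    have h2 := hQ.isLittleO_comp hP hl hk
    rw [add_comm l k] at h2
    refine (h1.sub h2).congr_left fun ε => ?_
    simp only [W]
    ring
  have hDO : (fun ε => Q (ε, P (ε, t)) - P (ε, Q (ε, t))) =O[𝓝 0] fun ε : ℂ => ε ^ (k + l) := by
    have h1 := hD.isBigO.add (pow_mul_const_isBigO (k + l) W)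
    simpa using h1
  have hε : (fun ε : ℂ => ε * (K (ε, t) - t)) =o[𝓝 0] fun ε => K (ε, t) - t := by
    have h1 : (fun ε : ℂ => ε) =o[𝓝 0] fun _ => (1 : ℂ) := by
      rw [isLittleO_one_iff]; exact tendsto_id
    simpa using h1.mul_isBigO (isBigO_refl (fun ε => K (ε, t) - t) (𝓝 0))
  -- The left-hand difference is S(K) - S(t). As S is the identity up to O(ε), it equals K - t up to
  -- a factor 1 + O(ε).
  have hequiv : (fun ε => (Q (ε, P (ε, t)) - P (ε, Q (ε, t))) - (K (ε, t) - t)) =o[𝓝 0]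
      fun ε => K (ε, t) - t := by
    have h1 := hS.isLittleO_sub one_ne_zero hK.tendsto tendsto_const_nhds
    simp only [pow_one] at h1
    have h2 := (h1.trans hε).add (hε.const_mul_left (deriv (epsCoeff 1 S) t))
    refine h2.congr' ?_ EventuallyEq.rfl
    filter_upwards [hSPQ, h] with ε h3 h4
    rw [h4, ← h3]
    ring
  have hKD : (fun ε => K (ε, t) - t) =O[𝓝 0] fun ε => Q (ε, P (ε, t)) - P (ε, Q (ε, t)) :=
    IsEquivalent.isBigO_symm hequiv
  refine (hD.sub (hequiv.trans_isBigO (hKD.trans hDO))).congr_left fun ε => ?_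
  ring

end Tangent

/-! ### The filtration of π₁ by the order of the first non-vanishing Melnikov function -/

section MelnikovFiltration

open scoped commutatorElement

variable {H : MvPolynomial (Fin 2) ℂ} {η : Fin 2 → MvPolynomial (Fin 2) ℂ} {Γ : ℂ → Fin 2 → ℂ}
  {t₀ : ℂ} {p₀ : Fiber H t₀}

variable (H η Γ) in
/-- The Melnikov functions of `δ` of orders `1, …, k - 1` vanish. -/
def MelnikovVanish (k : ℕ) (δ : PiOne (Fiber H t₀) p₀) : Prop :=
  ∀ j, j ≠ 0 → j < k → melnikov H η Γ j δ = 0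

theorem HolGerm.mk_zero {a : ℂ} : HolGerm.mk (0 : ℂ → ℂ) analyticAt_const = (0 : HolGerm a) :=
  rfl

theorem melnikov_eq_mk (j : ℕ) (δ : PiOne (Fiber H t₀) p₀) :
    ∃ h, melnikov H η Γ j δ = HolGerm.mk (epsCoeff j (holonomy H η Γ δ)) h :=
  ⟨_, rfl⟩

theorem melnikov_eq_zero_iff {j : ℕ} {δ : PiOne (Fiber H t₀) p₀} :
    melnikov H η Γ j δ = 0 ↔
      ∀ᶠ t in 𝓝 t₀, iteratedDeriv j (fun ε => holonomy H η Γ δ (ε, t)) 0 = 0 := by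
  rw [← HolGerm.mk_zero, melnikov, HolGerm.mk_eq_mk]
  refine eventually_congr (Eventually.of_forall fun t => ?_)
  simp [Nat.factorial_ne_zero]

theorem melnikovVanish_one (δ : PiOne (Fiber H t₀) p₀) : MelnikovVanish H η Γ 1 δ :=
  fun _ h0 h1 => absurd (Nat.lt_one_iff.mp h1) h0

theorem MelnikovVanish.mono {k l : ℕ} {δ : PiOne (Fiber H t₀) p₀} (h : MelnikovVanish H η Γ l δ)
    (hkl : k ≤ l) : MelnikovVanish H η Γ k δ :=
  fun j h0 hj => h j h0 (hj.trans_le hkl)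

theorem analyticAt_zero_mk_eventually {P : ℂ × ℂ → ℂ} {t : ℂ} (hP : AnalyticAt ℂ P (0, t)) :
    ∀ᶠ t' in 𝓝 t, AnalyticAt ℂ P (0, t') :=
  (Continuous.prodMk_right (0 : ℂ)).continuousAt.eventually hP.eventually_analyticAt

/-- Only finitely many orders are involved, so the vanishing of the germs at t₀ holds on one
neighbourhood, and the expansions can be made at each t near t₀ separately. -/
theorem MelnikovVanish.isTangentAt
    (hreg : ∀ z : Fin 2 → ℂ, eval z H = t₀ → ∃ i, eval z (pderiv i H) ≠ 0)
    (hΓ : IsTransversal H Γ p₀) {k : ℕ} {δ : PiOne (Fiber H t₀) p₀}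
    (h : MelnikovVanish H η Γ k δ) :
    ∀ᶠ t in 𝓝 t₀, IsTangentAt k (holonomy H η Γ δ) t := by
  have h1 : ∀ᶠ t in 𝓝 t₀, ∀ j ∈ Finset.range k, j ≠ 0 →
      iteratedDeriv j (fun ε => holonomy H η Γ δ (ε, t)) 0 = 0 := by
    rw [eventually_all_finset]
    intro j hj
    rcases eq_or_ne j 0 with h0 | h0
    · exact Eventually.of_forall fun t h => absurd h0 h
    · filter_upwards [melnikov_eq_zero_iff.mp (h j h0 (Finset.mem_range.mp hj))] with t ht _
      exact ht
  filter_upwards [analyticAt_zero_mk_eventually (holonomy_analyticAt H η Γ δ),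
    (h1.and (holonomy_zero (η := η) hreg hΓ δ)).eventually_nhds] with t ht1 ht2
  refine ⟨ht1, ht2.mono fun t' ht' => ⟨ht'.2, fun j h0 hj => ?_⟩⟩
  exact ht'.1 j (Finset.mem_range.mpr hj) h0

theorem holonomy_mul_eventually
    (hreg : ∀ z : Fin 2 → ℂ, eval z H = t₀ → ∃ i, eval z (pderiv i H) ≠ 0)
    (hΓ : IsTransversal H Γ p₀) (δ δ' : PiOne (Fiber H t₀) p₀) :
    ∀ᶠ t in 𝓝 t₀, ∀ᶠ ε in 𝓝 (0 : ℂ),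
      holonomy H η Γ (δ * δ') (ε, t) = holonomy H η Γ δ' (ε, holonomy H η Γ δ (ε, t)) := by
  have h1 := ((Continuous.prodMk_right (0 : ℂ)).tendsto t₀).eventually
    (holonomy_mul (η := η) hreg hΓ δ δ').eventually_nhds
  filter_upwards [h1] with t ht
  exact ((Continuous.prodMk_left t).tendsto (0 : ℂ)).eventually ht

/-- The first non-vanishing Melnikov function is additive. -/
theorem melnikov_mul (hreg : ∀ z : Fin 2 → ℂ, eval z H = t₀ → ∃ i, eval z (pderiv i H) ≠ 0)
    (hΓ : IsTransversal H Γ p₀) {k : ℕ} (hk : k ≠ 0) {δ δ' : PiOne (Fiber H t₀) p₀}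
    (h : MelnikovVanish H η Γ k δ) (h' : MelnikovVanish H η Γ k δ') :
    melnikov H η Γ k (δ * δ') = melnikov H η Γ k δ + melnikov H η Γ k δ' := by
  have key : epsCoeff k (holonomy H η Γ (δ * δ')) =ᶠ[𝓝 t₀]
      epsCoeff k (holonomy H η Γ δ) + epsCoeff k (holonomy H η Γ δ') := by
    filter_upwards [h.isTangentAt hreg hΓ, h'.isTangentAt hreg hΓ,
      analyticAt_zero_mk_eventually (holonomy_analyticAt H η Γ (δ * δ')),
      holonomy_mul_eventually (η := η) hreg hΓ δ δ'] with t h1 h2 h3 h4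
    exact h1.epsCoeff_comp h2 hk h3 h4
  exact HolGerm.mk_eq_mk.mpr key

theorem MelnikovVanish.mul (hreg : ∀ z : Fin 2 → ℂ, eval z H = t₀ → ∃ i, eval z (pderiv i H) ≠ 0)
    (hΓ : IsTransversal H Γ p₀) {k : ℕ} {δ δ' : PiOne (Fiber H t₀) p₀}
    (h : MelnikovVanish H η Γ k δ) (h' : MelnikovVanish H η Γ k δ') :
    MelnikovVanish H η Γ k (δ * δ') := by
  intro j h0 hj
  rw [melnikov_mul hreg hΓ h0 (h.mono hj.le) (h'.mono hj.le), h j h0 hj, h' j h0 hj, add_zero]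

/-- One order at a time: 1 · 1 = 1 and additivity give M = M + M. -/
theorem melnikovVanish_one_elem
    (hreg : ∀ z : Fin 2 → ℂ, eval z H = t₀ → ∃ i, eval z (pderiv i H) ≠ 0)
    (hΓ : IsTransversal H Γ p₀) (k : ℕ) :
    MelnikovVanish H η Γ k (1 : PiOne (Fiber H t₀) p₀) := by
  induction k with
  | zero => exact fun j _ hj => absurd hj j.not_lt_zero
  | succ k ih =>
    intro j h0 hj
    have hjk := ih.mono (Nat.lt_succ_iff.mp hj)
    have h := melnikov_mul hreg hΓ h0 hjk hjk
    rw [mul_one] at h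
    exact left_eq_add.mp h

/-- Additivity on δ δ⁻¹ = 1 in order j requires that the lower orders of δ⁻¹ vanish already, hence
the induction on k. -/
theorem MelnikovVanish.inv (hreg : ∀ z : Fin 2 → ℂ, eval z H = t₀ → ∃ i, eval z (pderiv i H) ≠ 0)
    (hΓ : IsTransversal H Γ p₀) {k : ℕ} {δ : PiOne (Fiber H t₀) p₀}
    (h : MelnikovVanish H η Γ k δ) : MelnikovVanish H η Γ k δ⁻¹ := by
  induction k with
  | zero => exact fun j _ hj => absurd hj j.not_lt_zero
  | succ k ih =>
    intro j h0 hj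
    have hjk := Nat.lt_succ_iff.mp hj
    have h1 := melnikov_mul hreg hΓ h0 (h.mono hj.le) ((ih (h.mono k.le_succ)).mono hjk)
    rw [mul_inv_cancel, h j h0 hj, melnikovVanish_one_elem hreg hΓ _ j h0 j.lt_succ_self,
      zero_add] at h1
    exact h1.symm

/-- The leading Melnikov function of a commutator is the Wronskian. -/
theorem MelnikovVanish.commutator
    (hreg : ∀ z : Fin 2 → ℂ, eval z H = t₀ → ∃ i, eval z (pderiv i H) ≠ 0)
    (hΓ : IsTransversal H Γ p₀) {k l : ℕ} (hk : k ≠ 0) (hl : l ≠ 0)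
    {α β : PiOne (Fiber H t₀) p₀} (hα : MelnikovVanish H η Γ k α)
    (hβ : MelnikovVanish H η Γ l β) :
    MelnikovVanish H η Γ (k + l) ⁅α, β⁆ ∧
      melnikov H η Γ (k + l) ⁅α, β⁆ =
        HolGerm.wronskian (melnikov H η Γ k α) (melnikov H η Γ l β) := by
  have key : ∀ᶠ t in 𝓝 t₀,
      (∀ j, j ≠ 0 → j < k + l → iteratedDeriv j (fun ε => holonomy H η Γ ⁅α, β⁆ (ε, t)) 0 = 0) ∧
      epsCoeff (k + l) (holonomy H η Γ ⁅α, β⁆) t =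
        epsCoeff k (holonomy H η Γ α) t * deriv (epsCoeff l (holonomy H η Γ β)) t -
          deriv (epsCoeff k (holonomy H η Γ α)) t * epsCoeff l (holonomy H η Γ β) t := by
    -- In this form only holonomies of products appear, with S that of βα and K that of the
    -- commutator.
    have e : ⁅α, β⁆ * (β * α) = α * β := by simp [commutatorElement_def, mul_assoc]
    have h3 := holonomy_mul_eventually (η := η) hreg hΓ ⁅α, β⁆ (β * α)
    rw [e] at h3
    filter_upwards [hα.isTangentAt hreg hΓ, hβ.isTangentAt hreg hΓ,
      (melnikovVanish_one (η := η) (Γ := Γ) (β * α)).isTangentAt hreg hΓ,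
      (melnikovVanish_one (η := η) (Γ := Γ) ⁅α, β⁆).isTangentAt hreg hΓ, h3,
      holonomy_mul_eventually (η := η) hreg hΓ α β,
      holonomy_mul_eventually (η := η) hreg hΓ β α] with t hP hQ hS hK h3 h4 h5
    refine hP.commutator hQ hk hl hS hK h5 ?_
    filter_upwards [h3, h4] with ε h6 h7
    rw [← h6, ← h7]
  refine ⟨fun j h0 hj => melnikov_eq_zero_iff.mpr (key.mono fun t ht => ht.1 j h0 hj), ?_⟩
  obtain ⟨h1, e1⟩ := melnikov_eq_mk (H := H) (η := η) (Γ := Γ) k α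
  obtain ⟨h2, e2⟩ := melnikov_eq_mk (H := H) (η := η) (Γ := Γ) l β
  obtain ⟨h3, e3⟩ := melnikov_eq_mk (H := H) (η := η) (Γ := Γ) (k + l) ⁅α, β⁆
  rw [e1, e2, e3, HolGerm.wronskian, HolGerm.del_mk, HolGerm.del_mk]
  change _ = HolGerm.mk (epsCoeff k (holonomy H η Γ α) * deriv (epsCoeff l (holonomy H η Γ β)) -
    deriv (epsCoeff k (holonomy H η Γ α)) * epsCoeff l (holonomy H η Γ β))
    ((h1.mul h2.deriv).sub (h1.deriv.mul h2))
  exact HolGerm.mk_eq_mk.mpr (key.mono fun t ht => ht.2)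

/-- The elements whose Melnikov functions of order less than `k` vanish form a subgroup. -/
def melnikovSubgroup (hreg : ∀ z : Fin 2 → ℂ, eval z H = t₀ → ∃ i, eval z (pderiv i H) ≠ 0)
    (hΓ : IsTransversal H Γ p₀) (η : Fin 2 → MvPolynomial (Fin 2) ℂ) (k : ℕ) :
    Subgroup (PiOne (Fiber H t₀) p₀) where
  carrier := {δ | MelnikovVanish H η Γ k δ}
  mul_mem' h h' := h.mul hreg hΓ h'
  one_mem' := melnikovVanish_one_elem hreg hΓ k
  inv_mem' h := h.inv hreg hΓ

/-- Every element has order at least 1, so a commutator with it raises the order by one. The series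
is indexed from zero, hence `n + 1` on the right. -/
theorem lowerCentralSeries_le_melnikovSubgroup
    (hreg : ∀ z : Fin 2 → ℂ, eval z H = t₀ → ∃ i, eval z (pderiv i H) ≠ 0)
    (hΓ : IsTransversal H Γ p₀) (n : ℕ) :
    (⊤ : Subgroup (PiOne (Fiber H t₀) p₀)).lowerCentralSeries n ≤
      melnikovSubgroup hreg hΓ η (n + 1) := by
  induction n with
  | zero => exact fun δ _ => melnikovVanish_one δ
  | succ n ih =>
    rw [Subgroup.lowerCentralSeries_succ, Subgroup.commutator_le]
    intro α hα β _
    exact (MelnikovVanish.commutator hreg hΓ n.succ_ne_zero one_ne_zero (ih hα)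
      (melnikovVanish_one β)).1

theorem melnikovVanish_of_mem_lcs
    (hreg : ∀ z : Fin 2 → ℂ, eval z H = t₀ → ∃ i, eval z (pderiv i H) ≠ 0)
    (hΓ : IsTransversal H Γ p₀) {k : ℕ+} {δ : PiOne (Fiber H t₀) p₀} (hδ : δ ∈ lcs _ k) :
    MelnikovVanish H η Γ k δ := by
  rw [← PNat.natPred_add_one k]
  exact lowerCentralSeries_le_melnikovSubgroup hreg hΓ _ hδ

end MelnikovFiltration

/-! ### Homomorphisms out of the graded Lie ring -/

section GradedHom

variable {G : Type*} [Group G]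

/-- A family of homomorphisms on the `L_k`, trivial on `L_{k+1}`, descends to `gr G`. -/
def Gr.lift {A : Type*} [AddCommGroup A] (f : ∀ k : ℕ+, lcs G k →* Multiplicative A)
    (hf : ∀ (k : ℕ+) (x : lcs G k), (x : G) ∈ lcs G (k + 1) → f k x = 1) : Gr G →+ A :=
  DirectSum.toAddMonoid fun k => MonoidHom.toAdditiveLeft
    (QuotientGroup.lift ((lcs G (k + 1)).subgroupOf (lcs G k)) (f k) fun x hx => hf k x hx)

theorem Gr.lift_cls {A : Type*} [AddCommGroup A] (f : ∀ k : ℕ+, lcs G k →* Multiplicative A)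
    (hf : ∀ (k : ℕ+) (x : lcs G k), (x : G) ∈ lcs G (k + 1) → f k x = 1) (k : ℕ+) (x : lcs G k) :
    Gr.lift f hf (Gr.cls k x) = (f k x).toAdd := by
  unfold Gr.lift Gr.cls Gr.of
  erw [DirectSum.toAddMonoid_of]
  rfl

/-- Compatibility with brackets can be checked on homogeneous elements. -/
theorem Gr.map_lie_of_cls {A : Type*} [LieRing A] (f : Gr G →+ A)
    (hf : ∀ (k l : ℕ+) (x : lcs G k) (y : lcs G l),
      f (Gr.cls (k + l) (lcsComm x y)) = ⁅f (Gr.cls k x), f (Gr.cls l y)⁆) (a b : Gr G) :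
    f ⁅a, b⁆ = ⁅f a, f b⁆ := by
  induction a using Gr.ind with
  | h0 => simp
  | ha a a' h h' => simp only [add_lie, map_add, h, h']
  | hc k x =>
    induction b using Gr.ind with
    | h0 => simp
    | ha b b' h h' => simp only [lie_add, map_add, h, h']
    | hc l y => rw [Gr.cls_bracket, hf]

end GradedHom

/-! ### The bracket of vector fields in one variable -/

section VectorFields

variable {a : ℂ}

theorem vectorField_add (f g : HolGerm a) :
    vectorField (f + g) = vectorField f + vectorField g :=
  Subtype.ext (add_smul f g _)

theorem vectorField_zero : vectorField (0 : HolGerm a) = 0 :=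
  Subtype.ext (zero_smul _ _)

/-- The second-order terms f g ∂² of the two compositions cancel. -/
theorem vectorField_lie (f g : HolGerm a) :
    ⁅vectorField f, vectorField g⁆ = vectorField (HolGerm.wronskian f g) := by
  apply Subtype.ext
  change ⁅f • HolGerm.del a, g • HolGerm.del a⁆ = HolGerm.wronskian f g • HolGerm.del a
  ext x
  simp only [Derivation.commutator_apply, Derivation.smul_apply, smul_eq_mul, Derivation.leibniz,
    HolGerm.wronskian]
  ring

end VectorFields

/-! ### The homomorphism given by the leading vector fields -/

section LeadingField

variable {H : MvPolynomial (Fin 2) ℂ} {η : Fin 2 → MvPolynomial (Fin 2) ℂ} {Γ : ℂ → Fin 2 → ℂ}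
  {t₀ : ℂ} {p₀ : Fiber H t₀}

theorem leadingField_lcsComm
    (hreg : ∀ z : Fin 2 → ℂ, eval z H = t₀ → ∃ i, eval z (pderiv i H) ≠ 0)
    (hΓ : IsTransversal H Γ p₀) {k l : ℕ+} (δ : lcs (PiOne (Fiber H t₀) p₀) k)
    (δ' : lcs (PiOne (Fiber H t₀) p₀) l) :
    leadingField H η Γ (k + l) (lcsComm δ δ') =
      ⁅leadingField H η Γ k δ, leadingField H η Γ l δ'⁆ := by
  unfold leadingField
  rw [vectorField_lie]
  exact congrArg vectorField (MelnikovVanish.commutator hreg hΓ k.ne_zero l.ne_zero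
    (melnikovVanish_of_mem_lcs hreg hΓ δ.2) (melnikovVanish_of_mem_lcs hreg hΓ δ'.2)).2

/-- The leading vector field as a homomorphism on `L_k`. -/
def leadingFieldHom (hreg : ∀ z : Fin 2 → ℂ, eval z H = t₀ → ∃ i, eval z (pderiv i H) ≠ 0)
    (hΓ : IsTransversal H Γ p₀) (η : Fin 2 → MvPolynomial (Fin 2) ℂ) (k : ℕ+) :
    lcs (PiOne (Fiber H t₀) p₀) k →* Multiplicative (VectorFieldGerm t₀) :=
  MonoidHom.mk' (fun δ => Multiplicative.ofAdd (leadingField H η Γ k δ)) fun δ δ' => by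
    rw [← ofAdd_add]
    unfold leadingField
    rw [← vectorField_add]
    exact congrArg (fun f => Multiplicative.ofAdd (vectorField f)) (melnikov_mul hreg hΓ k.ne_zero
      (melnikovVanish_of_mem_lcs hreg hΓ δ.2) (melnikovVanish_of_mem_lcs hreg hΓ δ'.2))

theorem leadingField_eq_zero
    (hreg : ∀ z : Fin 2 → ℂ, eval z H = t₀ → ∃ i, eval z (pderiv i H) ≠ 0)
    (hΓ : IsTransversal H Γ p₀) {k : ℕ+} (δ : lcs (PiOne (Fiber H t₀) p₀) k)
    (hδ : (δ : PiOne (Fiber H t₀) p₀) ∈ lcs _ (k + 1)) : leadingField H η Γ k δ = 0 := by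
  unfold leadingField
  rw [melnikovVanish_of_mem_lcs hreg hΓ hδ k k.ne_zero (by simp), vectorField_zero]

/-- The additive map on `gr π₁` induced by the leading vector fields. -/
def leadingFieldAddHom (hreg : ∀ z : Fin 2 → ℂ, eval z H = t₀ → ∃ i, eval z (pderiv i H) ≠ 0)
    (hΓ : IsTransversal H Γ p₀) (η : Fin 2 → MvPolynomial (Fin 2) ℂ) :
    Gr (PiOne (Fiber H t₀) p₀) →+ VectorFieldGerm t₀ :=
  Gr.lift (leadingFieldHom hreg hΓ η) fun _ δ hδ =>
    congrArg Multiplicative.ofAdd (leadingField_eq_zero (η := η) hreg hΓ δ hδ)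

theorem leadingFieldAddHom_cls
    (hreg : ∀ z : Fin 2 → ℂ, eval z H = t₀ → ∃ i, eval z (pderiv i H) ≠ 0)
    (hΓ : IsTransversal H Γ p₀) (k : ℕ+) (δ : lcs (PiOne (Fiber H t₀) p₀) k) :
    leadingFieldAddHom hreg hΓ η (Gr.cls k δ) = leadingField H η Γ k δ :=
  Gr.lift_cls _ _ k δ

/-- The homomorphism of Lie algebras induced by the leading vector fields. -/
def leadingFieldLieHom (hreg : ∀ z : Fin 2 → ℂ, eval z H = t₀ → ∃ i, eval z (pderiv i H) ≠ 0)
    (hΓ : IsTransversal H Γ p₀) (η : Fin 2 → MvPolynomial (Fin 2) ℂ) :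
    Gr (PiOne (Fiber H t₀) p₀) →ₗ⁅ℤ⁆ VectorFieldGerm t₀ :=
  { (leadingFieldAddHom hreg hΓ η).toIntLinearMap with
    map_lie' := fun {a b} => Gr.map_lie_of_cls (leadingFieldAddHom hreg hΓ η)
      (fun k l δ δ' => by
        simp only [leadingFieldAddHom_cls]
        exact leadingField_lcsComm hreg hΓ δ δ') a b }

theorem leadingFieldLieHom_cls
    (hreg : ∀ z : Fin 2 → ℂ, eval z H = t₀ → ∃ i, eval z (pderiv i H) ≠ 0)
    (hΓ : IsTransversal H Γ p₀) (k : ℕ+) (δ : lcs (PiOne (Fiber H t₀) p₀) k) :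
    leadingFieldLieHom hreg hΓ η (Gr.cls k δ) = leadingField H η Γ k δ :=
  leadingFieldAddHom_cls hreg hΓ k δ

end LeadingField

end

theorem mainTheorem8 (H : MvPolynomial (Fin 2) ℂ) (η : Fin 2 → MvPolynomial (Fin 2) ℂ) (t₀ : ℂ)
    (hreg : ∀ z : Fin 2 → ℂ, eval z H = t₀ → ∃ i, eval z (pderiv i H) ≠ 0)
    (p₀ : Fiber H t₀) (Γ : ℂ → Fin 2 → ℂ) (hΓ : IsTransversal H Γ p₀) :
    -- the holonomy along loops exists, is unique as a germ and depends on the homotopy class only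
    (∀ (γ : Path p₀ p₀) (P : ℂ × ℂ → ℂ),
      IsHolonomyAlong H η Γ γ P ↔ P =ᶠ[𝓝 ((0 : ℂ), t₀)] holonomy H η Γ (loopClass γ)) ∧
    -- the maps `v_{k,η}` induce a homomorphism of Lie algebras
    (∃! v : Gr (PiOne (Fiber H t₀) p₀) →ₗ⁅ℤ⁆ VectorFieldGerm t₀,
      ∀ (k : ℕ+) (δ : lcs (PiOne (Fiber H t₀) p₀) k),
        v (Gr.cls k δ) = leadingField H η Γ k δ) ∧
    -- commutators go to brackets, given by the Wronskian
    (∀ (k k' : ℕ+) (δ : lcs (PiOne (Fiber H t₀) p₀) k) (δ' : lcs (PiOne (Fiber H t₀) p₀) k'),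
      leadingField H η Γ (k + k') (lcsComm δ δ') =
        ⁅leadingField H η Γ k δ, leadingField H η Γ k' δ'⁆ ∧
      ⁅leadingField H η Γ k δ, leadingField H η Γ k' δ'⁆ =
        vectorField (HolGerm.wronskian
          (melnikov H η Γ k (δ : PiOne (Fiber H t₀) p₀))
          (melnikov H η Γ k' (δ' : PiOne (Fiber H t₀) p₀)))) := by
  refine ⟨isHolonomyAlong_iff hreg hΓ, ⟨leadingFieldLieHom hreg hΓ η,
    leadingFieldLieHom_cls hreg hΓ, fun v hv => ?_⟩, fun k k' δ δ' =>
    ⟨leadingField_lcsComm hreg hΓ δ δ', vectorField_lie _ _⟩⟩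
  -- Uniqueness: the classes of elements of the L_k generate the graded group additively.
  refine LieHom.ext fun a => ?_
  induction a using Gr.ind with
  | h0 => simp only [map_zero]
  | hc k δ => rw [hv, leadingFieldLieHom_cls]
  | ha a b ha hb => simp only [map_add, ha, hb]
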